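/- Let $K$ be a compact Hausdorff space, $\mathrm{C}(K)$ the Banach lattice of continuous complex-valued functions on $K$, and $\mathcal{S}$ a semigroup (under composition) of Markov operators on $\mathrm{C}(K)$, i.e. of bounded operators $T$ with $Tf\ge 0$ for $f\ge 0$ and $T\mathbb{1}=\mathbb{1}$. Assume that $\mathcal{S}$ is right amenable for the strong operator topology: there is a positive functional $m$ on the space $\mathrm{C}_b(\mathcal{S})$ of bounded strongly continuous complex functions with $m(\mathbb{1})=1$ and $m(\varphi(\,\cdot\,S))=m(\varphi)$ for all $S\in\mathcal{S}$, $\varphi\in \mathrm{C}_b(\mathcal{S})$. An invariant measure is a regular Borel probability measure $\mu$ on $K$ with $\int Tf\,d\mu=\int f\,d\mu$ for all $T\in\mathcal{S}$, $f\in \mathrm{C}(K)$. Such a $\mu$ is ergodic if the common fixed space in $\mathrm{L}^1(K,\mu)$ of the operators induced by the elements of $\mathcal{S}$ is one-dimensional. Let $I_\mu=\{f\in \mathrm{C}(K) : \int|f|\,d\mu=0\}$. An $\mathcal{S}$-ideal is a proper closed $\mathcal{S}$-invariant ideal of $\mathrm{C}(K)$, and $\mathrm{Prim}(\mathcal{S})$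 is the set of all $\mathcal{S}$-ideals of the form $I_\mu$ with $\mu$ ergodic. For $A\subset\mathrm{Prim}(\mathcal{S})$ put $\ker(A)=\bigcap_{p\in A}p$, where $\ker(\emptyset)=\mathrm{C}(K)$, and for $I\subset \mathrm{C}(K)$ put $\mathrm{hull}(I)=\{p\in\mathrm{Prim}(\mathcal{S}) : I\subset p\}$. Let $\mathrm{rad}_{\mathcal{S}}(0)=\bigcap_{p\in\mathrm{Prim}(\mathcal{S})}p$, let $\mathrm{M}(\mathcal{S})\subset K$ be its set of common zeros, and let $\mathcal{S}_{\mathrm{rad}}$ be the semigroup induced on $\mathrm{C}(\mathrm{M}(\mathcal{S}))$: its elements are the operators $f\mapsto (TF)|_{\mathrm{M}(\mathcal{S})}$, where $T\in\mathcal{S}$ and $F\in \mathrm{C}(K)$ is any extension of $f$. Equip $\mathrm{Prim}(\mathcal{S})$ with the hull-kernel topology, whose closed sets are the sets $A$ with $\mathrm{hull}(\ker(A))=A$. Then the following hold. 1. The closure of every $A\subset\mathrm{Prim}(\mathcal{S})$ in the hull-kernel topology is $\mathrm{hull}(\ker(A))$, the space $\mathrm{Prim}(\mathcal{S})$ is quasi-compact,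 and $\mathrm{M}(\mathcal{S})$ is the closure of the union of the supports of all ergodic measures. 2. The fixed space $\mathrm{fix}(\mathcal{S}_{\mathrm{rad}})=\{f\in \mathrm{C}(\mathrm{M}(\mathcal{S})) : Rf=f \text{ for all } R\in\mathcal{S}_{\mathrm{rad}}\}$ is a Banach sublattice of $\mathrm{C}(\mathrm{M}(\mathcal{S}))$, i.e. a closed linear subspace stable under complex conjugation and under $f\mapsto|f|$. 3. There is a well-defined map $$\hat{\ }\colon\mathrm{fix}(\mathcal{S}_{\mathrm{rad}})\longrightarrow \mathrm{C}(\mathrm{Prim}(\mathcal{S})),\qquad \hat f(I_\mu)=\int_{\mathrm{M}(\mathcal{S})}f\,d\mu\quad(\mu\text{ ergodic}),$$ and it is an isometric Markov lattice isomorphism onto $\mathrm{C}(\mathrm{Prim}(\mathcal{S}))$ with the supremum norm: it is linear, bijective and isometric, satisfies $\hat{\mathbb{1}}=\mathbb{1}$, commutes with complex conjugation and with the modulus, and $\hat f\ge0$ if and only if $f\ge 0$. -/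

import Mathlib

open MeasureTheory Topology
open scoped ComplexOrder BoundedContinuousFunction

namespace MarkovSemigroup

noncomputable section

/-! ### The complex Banach lattice of continuous functions -/

/-- The modulus `|f|` of a continuous complex-valued function. -/
def modulus {X : Type*} [TopologicalSpace X] (f : C(X, ℂ)) : C(X, ℂ) where
  toFun x := (‖f x‖ : ℂ)
  continuous_toFun := by fun_prop

/-- A Banach sublattice of the complex Banach lattice `C(X)`: a closed linear subspace which is
stable under complex conjugation (so it is the complexification of its real part) and under
the modulus. -/
structure IsBanachSublattice {X : Type*} [TopologicalSpace X] [CompactSpace X]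
    (V : Submodule ℂ C(X, ℂ)) : Prop where
  isClosed : IsClosed (V : Set C(X, ℂ))
  star_mem : ∀ f ∈ V, star f ∈ V
  modulus_mem : ∀ f ∈ V, modulus f ∈ V

/-- A linear bijection from a subspace `V` of `C(X)` onto `C(Y)` is a Markov lattice isomorphism
if it maps the constant function one to the constant function one, if it and its inverse are
positive, and if it commutes with complex conjugation and with the modulus. -/
structure IsMarkovLatticeIso {X Y : Type*} [TopologicalSpace X] [TopologicalSpace Y]
    (V : Submodule ℂ C(X, ℂ)) (Φ : V ≃ₗ[ℂ] C(Y, ℂ)) : Prop where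
  map_one : ∃ h : (1 : C(X, ℂ)) ∈ V, Φ ⟨1, h⟩ = 1
  nonneg_iff : ∀ f : V, 0 ≤ Φ f ↔ 0 ≤ (f : C(X, ℂ))
  map_star : ∀ f : V, ∃ h : star (f : C(X, ℂ)) ∈ V, Φ ⟨star (f : C(X, ℂ)), h⟩ = star (Φ f)
  map_modulus : ∀ f : V, ∃ h : modulus (f : C(X, ℂ)) ∈ V,
    Φ ⟨modulus (f : C(X, ℂ)), h⟩ = modulus (Φ f)

/-- The common fixed space of a set of linear operators. -/
def fixedSpace {E : Type*} [AddCommGroup E] [Module ℂ E] (𝒯 : Set (E →ₗ[ℂ] E)) :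
    Submodule ℂ E where
  carrier := {f | ∀ R ∈ 𝒯, R f = f}
  add_mem' {f g} hf hg R hR := by rw [map_add, hf R hR, hg R hR]
  zero_mem' R _ := map_zero R
  smul_mem' c f hf R hR := by rw [map_smul, hf R hR]

variable {K : Type*} [TopologicalSpace K] [CompactSpace K]

/-! ### Markov operators and right amenability -/

/-- A Markov operator: positive and unital. -/
structure IsMarkov (T : C(K, ℂ) →L[ℂ] C(K, ℂ)) : Prop where
  nonneg : ∀ f : C(K, ℂ), 0 ≤ f → 0 ≤ T f
  map_one : T 1 = 1

/-- The semigroup `S`, to be equipped with the strong operator topology. -/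
def StrongOp (S : Subsemigroup (C(K, ℂ) →L[ℂ] C(K, ℂ))) : Type _ := S

/-- The strong operator topology: the coarsest topology for which `T ↦ T f` is continuous, for
every `f`. -/
instance (S : Subsemigroup (C(K, ℂ) →L[ℂ] C(K, ℂ))) : TopologicalSpace (StrongOp S) :=
  TopologicalSpace.induced (fun (T : S) (f : C(K, ℂ)) => T.1 f) inferInstance

/-- Right translation of bounded continuous functions, `(R_s φ)(T) = φ (T s)`. -/
def rightTranslate (S : Subsemigroup (C(K, ℂ) →L[ℂ] C(K, ℂ))) (s : S) (φ : StrongOp S →ᵇ ℂ) :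
    StrongOp S →ᵇ ℂ :=
  φ.compContinuous
    { toFun := fun T : StrongOp S => (id (α := S) T * s : S)
      continuous_toFun := by
        refine continuous_induced_rng.2 (continuous_pi fun f => ?_)
        exact (continuous_apply (s.1 f)).comp continuous_induced_dom }

/-- Right amenability of `S` for the strong operator topology: there is a right invariant mean
on the bounded continuous functions. -/
def IsRightAmenable (S : Subsemigroup (C(K, ℂ) →L[ℂ] C(K, ℂ))) : Prop :=
  ∃ m : StrongDual ℂ (StrongOp S →ᵇ ℂ),
    (∀ φ : StrongOp S →ᵇ ℂ, (∀ T, 0 ≤ φ T) → 0 ≤ m φ) ∧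
    m (BoundedContinuousFunction.const _ 1) = 1 ∧
    ∀ (s : S) (φ : StrongOp S →ᵇ ℂ), m (rightTranslate S s φ) = m φ

/-! ### Invariant ideals and induced operators -/

/-- A closed ideal of `C(K)` that is invariant under the semigroup; it may be all of `C(K)`. -/
structure IsClosedInvariant (S : Subsemigroup (C(K, ℂ) →L[ℂ] C(K, ℂ))) (I : Ideal C(K, ℂ)) :
    Prop where
  isClosed : IsClosed (I : Set C(K, ℂ))
  invariant : ∀ T ∈ S, ∀ f ∈ I, T f ∈ I

/-- An `S`-ideal: a proper closed invariant ideal. -/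
structure IsSIdeal (S : Subsemigroup (C(K, ℂ) →L[ℂ] C(K, ℂ))) (I : Ideal C(K, ℂ)) : Prop
    extends IsClosedInvariant S I where
  ne_top : I ≠ ⊤

/-- The support of a closed ideal, its set of common zeros. It is the closed set `L` for which the
ideal consists of the functions vanishing on `L`. -/
def idealSupport {X : Type*} [TopologicalSpace X] (I : Ideal C(X, ℂ)) : Set X := {x | ∀ f ∈ I, f x = 0}

theorem isClosed_idealSupport {X : Type*} [TopologicalSpace X] (I : Ideal C(X, ℂ)) : IsClosed (idealSupport I) := by
  have : idealSupport I = ⋂ f ∈ I, {x | f x = 0} := by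
    ext x; simp [idealSupport]
  rw [this]
  exact isClosed_biInter fun f _ => isClosed_eq f.continuous continuous_const

instance (I : Ideal C(K, ℂ)) : CompactSpace (idealSupport I) :=
  isCompact_iff_compactSpace.1 (isClosed_idealSupport I).isCompact

theorem mem_iff_of_isClosed [T2Space K] {I : Ideal C(K, ℂ)} (hI : IsClosed (I : Set C(K, ℂ)))
    (f : C(K, ℂ)) : f ∈ I ↔ ∀ x ∈ idealSupport I, f x = 0 := by
  refine ⟨fun hf x hx => hx f hf, fun h => ?_⟩
  rw [← ContinuousMap.idealOfSet_ofIdeal_isClosed hI, ContinuousMap.mem_idealOfSet]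
  intro x hx
  refine h x fun g hg => ?_
  simpa using ContinuousMap.notMem_setOfIdeal.1 hx hg

/-- A continuous extension to `K` of a continuous function on the support of an ideal. -/
def extension [T2Space K] (I : Ideal C(K, ℂ)) (f : C(idealSupport I, ℂ)) : C(K, ℂ) :=
  (f.exists_restrict_eq (isClosed_idealSupport I)).choose

theorem extension_apply [T2Space K] (I : Ideal C(K, ℂ)) (f : C(idealSupport I, ℂ))
    (x : idealSupport I) : extension I f x = f x :=
  DFunLike.congr_fun (f.exists_restrict_eq (isClosed_idealSupport I)).choose_spec x

theorem apply_eq_of_eqOn [T2Space K] {I : Ideal C(K, ℂ)} (hI : IsClosed (I : Set C(K, ℂ)))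
    {T : C(K, ℂ) →L[ℂ] C(K, ℂ)} (hT : ∀ f ∈ I, T f ∈ I) {F G : C(K, ℂ)}
    (h : ∀ x : idealSupport I, F x = G x) (x : idealSupport I) : T F x = T G x := by
  have hm : F - G ∈ I := (mem_iff_of_isClosed hI _).2 fun y hy => by
    simpa [sub_eq_zero] using h ⟨y, hy⟩
  have := x.2 _ (hT _ hm)
  simpa [sub_eq_zero] using this

/-- The operator on `C(supp I)` induced by an operator which leaves the closed ideal `I` invariant:
`f ↦ (T F)|_{supp I}` for any continuous extension `F` of `f`. -/
def inducedOp [T2Space K] (I : Ideal C(K, ℂ)) (hI : IsClosed (I : Set C(K, ℂ)))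
    (T : C(K, ℂ) →L[ℂ] C(K, ℂ)) (hT : ∀ f ∈ I, T f ∈ I) :
    C(idealSupport I, ℂ) →ₗ[ℂ] C(idealSupport I, ℂ) where
  toFun f := (T (extension I f)).restrict (idealSupport I)
  map_add' f g := by
    ext x
    have := apply_eq_of_eqOn hI hT (F := extension I (f + g))
      (G := extension I f + extension I g) (fun y => by simp [extension_apply]) x
    simpa using this
  map_smul' c f := by
    ext x
    have := apply_eq_of_eqOn hI hT (F := extension I (c • f))
      (G := c • extension I f) (fun y => by simp [extension_apply]) x
    simpa using this

/-- The induced operator does not depend on the chosen extension. -/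
theorem inducedOp_restrict [T2Space K] (I : Ideal C(K, ℂ)) (hI : IsClosed (I : Set C(K, ℂ)))
    (T : C(K, ℂ) →L[ℂ] C(K, ℂ)) (hT : ∀ f ∈ I, T f ∈ I) (F : C(K, ℂ)) :
    inducedOp I hI T hT (F.restrict (idealSupport I)) = (T F).restrict (idealSupport I) := by
  ext x
  exact apply_eq_of_eqOn hI hT (fun y => by simp [extension_apply]) x

/-- The semigroup on `C(supp I)` induced by `S`. -/
def inducedSemigroup [T2Space K] (S : Subsemigroup (C(K, ℂ) →L[ℂ] C(K, ℂ)))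
    (I : Ideal C(K, ℂ)) (hI : IsClosedInvariant S I) :
    Set (C(idealSupport I, ℂ) →ₗ[ℂ] C(idealSupport I, ℂ)) :=
  {R | ∃ (T : C(K, ℂ) →L[ℂ] C(K, ℂ)) (hT : T ∈ S),
    R = inducedOp I hI.isClosed T (hI.invariant T hT)}

/-! ### Invariant and ergodic measures -/

variable [MeasurableSpace K] [BorelSpace K]

theorem integrable_continuousMap {E : Type*} [NormedAddCommGroup E] [SecondCountableTopology E]
    (μ : ProbabilityMeasure K) (f : C(K, E)) : Integrable f (μ : Measure K) :=
  f.continuous.integrable_of_hasCompactSupport (HasCompactSupport.of_compactSpace _)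

/-- `μ` is an invariant regular Borel probability measure. -/
structure IsInvariantMeasure (S : Subsemigroup (C(K, ℂ) →L[ℂ] C(K, ℂ)))
    (μ : ProbabilityMeasure K) : Prop where
  regular : (μ : Measure K).Regular
  integral_eq : ∀ T ∈ S, ∀ f : C(K, ℂ), ∫ x, T f x ∂(μ : Measure K) = ∫ x, f x ∂(μ : Measure K)

/-- The absolute kernel `I_μ = {f | ⟨|f|, μ⟩ = 0}`. -/
def absKernel (μ : ProbabilityMeasure K) : Ideal C(K, ℂ) where
  carrier := {f | ∫ x, ‖f x‖ ∂(μ : Measure K) = 0}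
  zero_mem' := by simp
  add_mem' {f g} hf hg := by
    simp only [Set.mem_ofPred_eq] at hf hg ⊢
    refine le_antisymm ?_ (integral_nonneg fun x => norm_nonneg _)
    have h := integral_mono (integrable_continuousMap μ (f + g)).norm
      ((integrable_continuousMap μ f).norm.add (integrable_continuousMap μ g).norm)
      fun x => norm_add_le (f x) (g x)
    refine h.trans (le_of_eq ?_)
    have := integral_add (integrable_continuousMap μ f).norm (integrable_continuousMap μ g).norm
    rw [hf, hg, add_zero] at this
    exact this
  smul_mem' c f hf := by
    simp only [Set.mem_ofPred_eq] at hf ⊢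
    refine le_antisymm ?_ (integral_nonneg fun x => norm_nonneg _)
    have h := integral_mono (integrable_continuousMap μ (c • f)).norm
      ((integrable_continuousMap μ f).norm.const_mul ‖c‖) fun x => by
        simp only [smul_eq_mul, ContinuousMap.mul_apply, norm_mul]
        exact mul_le_mul_of_nonneg_right (c.norm_coe_le_norm x) (norm_nonneg _)
    rwa [integral_const_mul, hf, mul_zero] at h

/-- The operator on `L¹(K, μ)` induced by an operator `T` on `C(K)`: the unique continuous extension
of `[f] ↦ [T f]` along the dense map `C(K) → L¹(K, μ)`. -/
def lOneOp (μ : ProbabilityMeasure K) (T : C(K, ℂ) →L[ℂ] C(K, ℂ)) :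
    Lp ℂ 1 (μ : Measure K) →L[ℂ] Lp ℂ 1 (μ : Measure K) :=
  ((ContinuousMap.toLp 1 (μ : Measure K) ℂ).comp T).toLinearMap.extendOfNorm
    (ContinuousMap.toLp 1 (μ : Measure K) ℂ : C(K, ℂ) →L[ℂ] Lp ℂ 1 (μ : Measure K)).toLinearMap

/-- Positive operators satisfy `|T f| ≤ T |f|`. -/
theorem norm_apply_le {X : Type*} [TopologicalSpace X] [CompactSpace X]
    {T : C(X, ℂ) →L[ℂ] C(X, ℂ)} (hT : IsMarkov T) (f : C(X, ℂ)) (x : X) :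
    ‖T f x‖ ≤ (T (modulus f) x).re := by
  have hre : ∀ u : C(X, ℂ), (∀ y, (u y).im = 0) → (T u x).im = 0 := by
    intro u hu
    have h := hT.nonneg (u + (‖u‖ : ℂ) • (1 : C(X, ℂ))) fun y => by
      change (0 : ℂ) ≤ u y + (‖u‖ : ℂ) * 1
      rw [Complex.nonneg_iff]
      have h1 := (abs_le.1 ((Complex.abs_re_le_norm (u y)).trans (u.norm_coe_le_norm y))).1
      simp [hu y]
      linarith
    have h2 := (Complex.nonneg_iff.1 (h x)).2
    rw [map_add, map_smul, hT.map_one] at h2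
    simpa using h2.symm
  obtain ⟨c, hc, hcx⟩ : ∃ c : ℂ, ‖c‖ = 1 ∧ c * T f x = ‖T f x‖ := by
    obtain ⟨c, hc, h⟩ := RCLike.exists_norm_eq_mul_self (T f x)
    exact ⟨c, hc, h.symm⟩
  let u : C(X, ℂ) := ⟨fun y => ((c * f y).re : ℂ), by fun_prop⟩
  let v : C(X, ℂ) := ⟨fun y => ((c * f y).im : ℂ), by fun_prop⟩
  have huv : c • f = u + Complex.I • v := by
    ext y
    simp only [u, v, ContinuousMap.smul_apply, ContinuousMap.add_apply, ContinuousMap.coe_mk,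
      smul_eq_mul]
    rw [mul_comm Complex.I, Complex.re_add_im]
  have hv : (T v x).im = 0 := hre v fun y => by simp [v]
  have h1 : (‖T f x‖ : ℂ) = T u x + Complex.I * T v x := by
    rw [← hcx]
    have := congrArg (fun g => T g x) huv
    simpa using this
  have h2 : ‖T f x‖ = (T u x).re := by
    have := congrArg Complex.re h1
    simpa [hv] using this
  have h3 := hT.nonneg (modulus f - u) fun y => by
    change (0 : ℂ) ≤ (‖f y‖ : ℂ) - ((c * f y).re : ℂ)
    rw [Complex.nonneg_iff]
    have := (Complex.re_le_norm (c * f y)).trans_eq (by rw [norm_mul, hc, one_mul])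
    constructor
    · simpa using this
    · simp
  have h4 := (Complex.nonneg_iff.1 (h3 x)).1
  rw [map_sub] at h4
  simp at h4
  linarith

/-- The induced operator on `L¹(K, μ)` really extends `[f] ↦ [T f]`. -/
theorem lOneOp_toLp [T2Space K] {S : Subsemigroup (C(K, ℂ) →L[ℂ] C(K, ℂ))}
    {μ : ProbabilityMeasure K} (hμ : IsInvariantMeasure S μ) {T : C(K, ℂ) →L[ℂ] C(K, ℂ)}
    (hTS : T ∈ S) (hT : IsMarkov T) (f : C(K, ℂ)) :
    lOneOp μ T (ContinuousMap.toLp 1 (μ : Measure K) ℂ f) =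
      ContinuousMap.toLp 1 (μ : Measure K) ℂ (T f) := by
  have := hμ.regular
  have hnorm : ∀ g : C(K, ℂ), ‖(ContinuousMap.toLp 1 (μ : Measure K) ℂ g)‖ =
      ∫ x, ‖g x‖ ∂(μ : Measure K) := fun g => by
    rw [L1.norm_eq_integral_norm]
    refine integral_congr_ae ?_
    filter_upwards [ContinuousMap.coeFn_toLp (p := 1) (𝕜 := ℂ) (μ : Measure K) g] with x hx
    rw [hx]
  have hdense : DenseRange (ContinuousMap.toLp 1 (μ : Measure K) ℂ :
      C(K, ℂ) →L[ℂ] Lp ℂ 1 (μ : Measure K)) :=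
    ContinuousMap.toLp_denseRange ℂ (μ : Measure K) ℂ ENNReal.one_ne_top
  refine LinearMap.extendOfNorm_eq
    (f := ((ContinuousMap.toLp 1 (μ : Measure K) ℂ).comp T).toLinearMap)
    (e := (ContinuousMap.toLp 1 (μ : Measure K) ℂ :
      C(K, ℂ) →L[ℂ] Lp ℂ 1 (μ : Measure K)).toLinearMap) hdense ⟨1, fun g => ?_⟩ f
  have h1 : ∫ x, ‖T g x‖ ∂(μ : Measure K) ≤ ∫ x, (T (modulus g) x).re ∂(μ : Measure K) :=
    integral_mono (integrable_continuousMap μ (T g)).norm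
      (integrable_continuousMap μ (T (modulus g))).re fun x => norm_apply_le hT g x
  have h2 : ∫ x, (T (modulus g) x).re ∂(μ : Measure K) = ∫ x, ‖g x‖ ∂(μ : Measure K) := by
    have h3 := integral_re (𝕜 := ℂ) (integrable_continuousMap μ (T (modulus g)))
    have h4 := integral_re (𝕜 := ℂ) (integrable_continuousMap μ (modulus g))
    simp only [RCLike.re_eq_complex_re] at h3 h4
    rw [h3, hμ.integral_eq T hTS, ← h4]
    simp [modulus]
  have h5 : ‖ContinuousMap.toLp 1 (μ : Measure K) ℂ (T g)‖ ≤
      1 * ‖ContinuousMap.toLp 1 (μ : Measure K) ℂ g‖ := by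
    rw [hnorm, hnorm, one_mul, ← h2]
    exact h1
  exact h5

/-- An invariant measure is ergodic if the fixed space in `L¹(K, μ)` of the induced semigroup is
one-dimensional. -/
structure IsErgodicMeasure (S : Subsemigroup (C(K, ℂ) →L[ℂ] C(K, ℂ)))
    (μ : ProbabilityMeasure K) : Prop extends IsInvariantMeasure S μ where
  finrank_eq_one : Module.finrank ℂ
    (fixedSpace {R : Lp ℂ 1 (μ : Measure K) →ₗ[ℂ] Lp ℂ 1 (μ : Measure K) |
      ∃ T ∈ S, R = (lOneOp μ T).toLinearMap}) = 1

/-! ### The primitive spectrum and its hull-kernel topology -/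

/-- The primitive spectrum: the set of `S`-ideals that are absolute kernels of ergodic measures. -/
def Prim (S : Subsemigroup (C(K, ℂ) →L[ℂ] C(K, ℂ))) : Type _ :=
  {p : Ideal C(K, ℂ) // IsSIdeal S p ∧ ∃ μ : ProbabilityMeasure K,
    IsErgodicMeasure S μ ∧ p = absKernel μ}

/-- A primitive ideal, as an ideal of `C(K)`. -/
def Prim.ideal {S : Subsemigroup (C(K, ℂ) →L[ℂ] C(K, ℂ))} (p : Prim S) : Ideal C(K, ℂ) := p.1

/-- The kernel of a set of primitive ideals, their intersection. -/
def ker {S : Subsemigroup (C(K, ℂ) →L[ℂ] C(K, ℂ))} (A : Set (Prim S)) : Ideal C(K, ℂ) :=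
  ⨅ p ∈ A, p.ideal

/-- The hull of a subset of `C(K)`: the set of primitive ideals containing it. -/
def hull (S : Subsemigroup (C(K, ℂ) →L[ℂ] C(K, ℂ))) (I : Set C(K, ℂ)) : Set (Prim S) :=
  {p | I ⊆ p.ideal}

/-- The radical of a subset of `C(K)`. -/
def rad (S : Subsemigroup (C(K, ℂ) →L[ℂ] C(K, ℂ))) (I : Set C(K, ℂ)) : Ideal C(K, ℂ) :=
  ker (hull S I)

theorem isClosedInvariant_rad (S : Subsemigroup (C(K, ℂ) →L[ℂ] C(K, ℂ))) (I : Set C(K, ℂ)) :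
    IsClosedInvariant S (rad S I) where
  isClosed := by
    have : (rad S I : Set C(K, ℂ)) = ⋂ p ∈ hull S I, (p.ideal : Set C(K, ℂ)) := by
      ext f; simp [rad, ker]
    rw [this]
    exact isClosed_biInter fun p _ => p.2.1.isClosed
  invariant T hT f hf := by
    simp only [rad, ker, Submodule.mem_iInf] at hf ⊢
    exact fun p hp => p.2.1.invariant T hT f (hf p hp)

/-- The hull-kernel topology: the topology whose closed sets are the sets `A` with
`hull (ker A) = A`. -/
instance (S : Subsemigroup (C(K, ℂ) →L[ℂ] C(K, ℂ))) : TopologicalSpace (Prim S) :=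
  TopologicalSpace.generateFrom {U | hull S (ker Uᶜ) = Uᶜ}

/-- The set `M(S)`, the support of the radical of the zero ideal. -/
abbrev radSupport (S : Subsemigroup (C(K, ℂ) →L[ℂ] C(K, ℂ))) : Set K :=
  idealSupport (rad S {0})

/-- The fixed space in `C(M(S))` of the semigroup induced by `S` on `C(M(S))`. -/
def radFixedSpace [T2Space K] (S : Subsemigroup (C(K, ℂ) →L[ℂ] C(K, ℂ))) :
    Submodule ℂ C(radSupport S, ℂ) :=
  fixedSpace (inducedSemigroup S (rad S {0}) (isClosedInvariant_rad S {0}))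

end

end MarkovSemigroup

/-! Everything rests on two facts about ergodic measures. The first is existence: every `S`-ideal
`I` lies below the absolute kernel of an ergodic measure. Averaging an orbit `T ↦ T u x`, with `x` a
common zero of `I`, by the right invariant mean gives an invariant state that annihilates `I`. Such
states form a weak* compact set, so an extreme one exists by Krein–Milman, and extremality forces
ergodicity. Indeed, let `t` be a truncation at level `N` of the real or imaginary part of a fixed
vector in `L¹(μ)`, and let `a` be its mean. The measures with densities `1 ± (t - a) / (2N)` are
again invariant, and `μ` is their midpoint, so `t = a` almost everywhere
(`isErgodicMeasure_of_extreme`). Their invariance is the analytic core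
(`integral_truncate_mul_apply`): a Markov operator preserving `μ` almost commutes with
multiplication by a function that it almost fixes in `L¹`. The second fact is a zero-one law: the
support of a closed invariant ideal has an indicator function fixed in `L¹(μ)`, hence measure zero
or one for ergodic `μ`. Therefore absolute kernels of ergodic measures are prime among closed
invariant ideals, which is what makes `A ↦ hull (ker A)` a topological closure. Existence then
yields the rest. Closed invariant ideals with a common zero lie below a single primitive ideal
(`exists_prim_ge`), so compactness of `K` passes to `Prim S`. By ergodicity the fixed functions on
`M(S)` are those constant on the support of each primitive ideal; they descend to `Prim S`,
isometrically because the supports have dense union in `M(S)`. Conversely, `exists_prim_ge` assigns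
to each point of `M(S)` a primitive ideal through which any continuous function on `Prim S` lifts.
-/

namespace MarkovSemigroup

noncomputable section

set_option linter.unusedSectionVars false

/-! ### Real Markov operators preserving a measure -/

section RealMarkov

variable {K : Type*} [TopologicalSpace K] [CompactSpace K]

/-- A positive unital linear operator on real continuous functions. -/
structure IsRealMarkov (P : C(K, ℝ) →ₗ[ℝ] C(K, ℝ)) : Prop where
  nonneg : ∀ u : C(K, ℝ), 0 ≤ u → 0 ≤ P u
  map_one : P 1 = 1

namespace IsRealMarkov

variable {P : C(K, ℝ) →ₗ[ℝ] C(K, ℝ)}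

theorem mono (hP : IsRealMarkov P) {u v : C(K, ℝ)} (h : ∀ x, u x ≤ v x) (x : K) :
    P u x ≤ P v x := by
  have h1 := hP.nonneg (v - u) (fun y => by simpa using h y) x
  rw [map_sub] at h1
  simpa using h1

theorem map_const (hP : IsRealMarkov P) (a : ℝ) :
    P (ContinuousMap.const K a) = ContinuousMap.const K a := by
  have : ContinuousMap.const K a = a • (1 : C(K, ℝ)) := by ext; simp
  rw [this, map_smul, hP.map_one]

/-- The pointwise variance `P ((w x - w)²) x` of `w`. -/
def localVariance (P : C(K, ℝ) →ₗ[ℝ] C(K, ℝ)) (w : C(K, ℝ)) : C(K, ℝ) :=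
  w * w - (2 : ℝ) • (w * P w) + P (w * w)

theorem localVariance_apply (hP : IsRealMarkov P) (w : C(K, ℝ)) (x : K) :
    localVariance P w x =
      P ((ContinuousMap.const K (w x) - w) * (ContinuousMap.const K (w x) - w)) x := by
  have : (ContinuousMap.const K (w x) - w) * (ContinuousMap.const K (w x) - w) =
      (w x * w x) • (1 : C(K, ℝ)) - (2 * w x) • w + w * w := by
    ext y; simp; ring
  rw [this, map_add, map_sub, map_smul, map_smul, hP.map_one]
  simp [localVariance]
  ring

/-- At the point `x` the difference is `P ((w x - w) g) x`, so it is small where `w` has small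
variance. Young's inequality with a free `ε` stands in for Cauchy–Schwarz, which keeps the bound
linear in the variance and ready for integration. -/
theorem abs_mul_apply_sub_le (hP : IsRealMarkov P) (w g : C(K, ℝ)) {ε : ℝ} (hε : 0 < ε) (x : K) :
    |w x * P g x - P (w * g) x| ≤ ‖g‖ * (ε + localVariance P w x / (4 * ε)) := by
  -- A one-sided bound for all `v` of the same norm suffices: `g` and `-g` together give the
  -- absolute value.
  have key : ∀ v : C(K, ℝ), ‖v‖ = ‖g‖ →
      w x * P v x - P (w * v) x ≤ ‖g‖ * (ε + localVariance P w x / (4 * ε)) := by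
    intro v hv
    have h := hP.mono (u := w x • v - w * v)
      (v := (‖g‖ * ε) • (1 : C(K, ℝ)) + (‖g‖ / (4 * ε)) •
        ((ContinuousMap.const K (w x) - w) * (ContinuousMap.const K (w x) - w)))
      (fun y => by
        simp only [ContinuousMap.sub_apply, ContinuousMap.smul_apply, ContinuousMap.mul_apply,
          ContinuousMap.add_apply, ContinuousMap.const_apply, ContinuousMap.one_apply, smul_eq_mul]
        set d := w x - w y with hd
        have h1 : |v y| ≤ ‖g‖ := hv ▸ v.norm_coe_le_norm y
        have h2 : |d| ≤ ε + d * d / (4 * ε) := by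
          rw [← sub_nonneg]
          have : ε + d * d / (4 * ε) - |d| = (2 * ε - |d|) ^ 2 / (4 * ε) := by
            field_simp
            nlinarith [abs_mul_abs_self d]
          rw [this]; positivity
        calc w x * v y - w y * v y = d * v y := by rw [hd]; ring
          _ ≤ |d| * |v y| := by rw [← abs_mul]; exact le_abs_self _
          _ ≤ (ε + d * d / (4 * ε)) * ‖g‖ :=
              mul_le_mul h2 h1 (abs_nonneg _) ((abs_nonneg d).trans h2)
          _ = _ := by ring) x
    rw [map_sub, map_add, map_smul, map_smul, map_smul, hP.map_one] at h
    simp only [ContinuousMap.sub_apply, ContinuousMap.smul_apply,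
          ContinuousMap.add_apply, ContinuousMap.one_apply, smul_eq_mul] at h
    rw [← hP.localVariance_apply] at h
    refine h.trans (le_of_eq (by ring))
  rw [abs_le]
  have h1 := key g rfl
  have h2 := key (-g) (norm_neg g)
  simp only [mul_neg, map_neg, ContinuousMap.neg_apply] at h2
  constructor <;> linarith

end IsRealMarkov

variable [MeasurableSpace K] [BorelSpace K]

theorem integrable_real (μ : ProbabilityMeasure K) (u : C(K, ℝ)) :
    Integrable (fun x => u x) (μ : Measure K) := integrable_continuousMap μ u

namespace IsRealMarkov

variable {P : C(K, ℝ) →ₗ[ℝ] C(K, ℝ)} {μ : ProbabilityMeasure K}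

/-- The `L¹`-distance between a function and its image under an operator. -/
def defect (P : C(K, ℝ) →ₗ[ℝ] C(K, ℝ)) (μ : ProbabilityMeasure K) (u : C(K, ℝ)) : ℝ :=
  ∫ x, |P u x - u x| ∂(μ : Measure K)

/-- Positivity gives `P v ≥ P u ⊔ a`, so the negative part of `P v - v` is at most `|P u - u|`.
Since `P v - v` has integral zero, its positive part has the same integral as its negative part. -/
theorem defect_sup_const_le (hP : IsRealMarkov P)
    (hμ : ∀ u : C(K, ℝ), ∫ x, P u x ∂(μ : Measure K) = ∫ x, u x ∂(μ : Measure K))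
    (u : C(K, ℝ)) (a : ℝ) :
    defect P μ (u ⊔ ContinuousMap.const K a) ≤ 2 * defect P μ u := by
  set v := u ⊔ ContinuousMap.const K a with hv
  have hvx : ∀ x, v x = max (u x) a := fun x => by simp [hv]
  set z := P u ⊔ ContinuousMap.const K a with hz
  have hzx : ∀ x, z x = max (P u x) a := fun x => by simp [hz]
  have h1 : ∀ x, z x ≤ P v x := fun x => by
    rw [hzx]
    refine max_le (hP.mono (fun y => by rw [hvx]; exact le_max_left _ _) x) ?_
    have := hP.mono (u := ContinuousMap.const K a) (v := v)
      (fun y => by rw [hvx]; exact le_max_right _ _) x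
    rwa [hP.map_const] at this
  have h2 : ∀ x, |z x - v x| ≤ |P u x - u x| := fun x => by
    rw [hzx, hvx]; exact abs_max_sub_max_le_abs _ _ _
  have h3 : ∀ x, |P v x - v x| ≤ (P v x - v x) + 2 * |P u x - u x| := fun x => by
    have := h1 x; have h2' := h2 x
    rw [abs_le] at h2'
    rw [abs_le]
    have := abs_nonneg (P u x - u x)
    constructor <;> linarith
  have hi : Integrable (fun x => P v x - v x) (μ : Measure K) :=
    (integrable_real μ (P v)).sub (integrable_real μ v)
  have hi' : Integrable (fun x => |P u x - u x|) (μ : Measure K) :=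
    ((integrable_real μ (P u)).sub (integrable_real μ u)).abs
  calc defect P μ v ≤ ∫ x, ((P v x - v x) + 2 * |P u x - u x|) ∂(μ : Measure K) :=
        integral_mono hi.abs (hi.add (hi'.const_mul 2)) h3
    _ = 2 * defect P μ u := by
        rw [integral_add hi (hi'.const_mul 2), integral_const_mul,
          integral_sub (integrable_real μ (P v)) (integrable_real μ v), hμ, sub_self, zero_add,
          defect]

theorem defect_neg (u : C(K, ℝ)) : defect P μ (-u) = defect P μ u := by
  simp only [defect, map_neg, ContinuousMap.neg_apply]
  refine integral_congr_ae (.of_forall fun x => ?_)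
  simp only
  rw [← abs_neg]; congr 1; ring

theorem defect_inf_const_le (hP : IsRealMarkov P)
    (hμ : ∀ u : C(K, ℝ), ∫ x, P u x ∂(μ : Measure K) = ∫ x, u x ∂(μ : Measure K))
    (u : C(K, ℝ)) (a : ℝ) :
    defect P μ (u ⊓ ContinuousMap.const K a) ≤ 2 * defect P μ u := by
  have h := hP.defect_sup_const_le hμ (-u) (-a)
  rw [defect_neg] at h
  convert h using 1
  rw [← defect_neg]
  congr 1
  ext x
  simp [← max_neg_neg]

/-- Invariance replaces `∫ w g` by `∫ P (w g)`, and the pointwise commutator estimate is integrated.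
The defect of `w` controls its mean variance. -/
theorem abs_integral_mul_apply_sub_le (hP : IsRealMarkov P)
    (hμ : ∀ u : C(K, ℝ), ∫ x, P u x ∂(μ : Measure K) = ∫ x, u x ∂(μ : Measure K))
    (w g : C(K, ℝ)) {N : ℝ} (hw : ∀ x, |w x| ≤ N) {ε : ℝ} (hε : 0 < ε) :
    |∫ x, w x * P g x ∂(μ : Measure K) - ∫ x, w x * g x ∂(μ : Measure K)| ≤
      ‖g‖ * (ε + 2 * N * defect P μ w / (4 * ε)) := by
  have e1 : ∫ x, w x * g x ∂(μ : Measure K) = ∫ x, P (w * g) x ∂(μ : Measure K) :=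
    (hμ (w * g)).symm
  -- Invariance turns `∫ P (w²)` into `∫ w²`, so the integral equals `2 ∫ w (w - P w)`.
  have hv : ∫ x, localVariance P w x ∂(μ : Measure K) ≤ 2 * N * defect P μ w := by
    have e2 : ∫ x, localVariance P w x ∂(μ : Measure K) =
        ∫ x, 2 * (w x * (w x - P w x)) ∂(μ : Measure K) := by
      have i1 := integrable_real μ (w * w - (2 : ℝ) • (w * P w))
      have : ∫ x, localVariance P w x ∂(μ : Measure K) =
        ∫ x, (w * w - (2 : ℝ) • (w * P w)) x ∂(μ : Measure K) + ∫ x, (w * w) x ∂(μ : Measure K) := by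
        rw [← hμ (w * w), ← integral_add i1 (integrable_real μ _)]
        rfl
      rw [this, ← integral_add i1 (integrable_real μ _)]
      refine integral_congr_ae (.of_forall fun x => ?_)
      simp
      ring
    rw [e2, defect, ← integral_const_mul]
    refine integral_mono (integrable_real μ ((2 : ℝ) • (w * (w - P w))))
      (((integrable_real μ (P w)).sub (integrable_real μ w)).abs.const_mul _) fun x => ?_
    simp only
    calc 2 * (w x * (w x - P w x)) ≤ 2 * (|w x| * |w x - P w x|) := by
          rw [← abs_mul]; gcongr; exact le_abs_self _
      _ ≤ 2 * (N * |w x - P w x|) := by gcongr; exact hw x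
      _ = _ := by rw [abs_sub_comm]; ring
  have e2 := integral_sub (integrable_real μ (w * P g)) (integrable_real μ (P (w * g)))
  simp only [ContinuousMap.mul_apply] at e2
  rw [e1, ← e2]
  refine (abs_integral_le_integral_abs).trans ?_
  have h := integral_mono (((integrable_real μ (w * P g)).sub (integrable_real μ (P (w * g)))).abs)
    (((integrable_const (μ := (μ : Measure K)) ε).add
      ((integrable_real μ (localVariance P w)).div_const (4 * ε))).const_mul ‖g‖)
    (fun x => hP.abs_mul_apply_sub_le w g hε x)
  refine h.trans ?_
  rw [integral_const_mul]
  gcongr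
  have := integral_add (integrable_const (μ := (μ : Measure K)) ε)
      ((integrable_real μ (localVariance P w)).div_const (4 * ε))
  refine this.le.trans ?_
  rw [integral_div]
  simp
  gcongr

/-- Truncation of a real number to `[-N, N]`. -/
def truncate (N t : ℝ) : ℝ := min (max t (-N)) N

theorem abs_truncate_le {N : ℝ} (hN : 0 ≤ N) (t : ℝ) : |truncate N t| ≤ N := by
  rw [abs_le, truncate]
  exact ⟨le_min (le_max_right _ _) (by linarith), min_le_right _ _⟩

theorem abs_truncate_sub_le (N s t : ℝ) : |truncate N s - truncate N t| ≤ |s - t| :=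
  (abs_min_sub_min_le_max _ N _ N).trans (max_le (abs_max_sub_max_le_abs _ _ _) (by simp))

theorem truncate_eq_self {N t : ℝ} (h : |t| ≤ N) : truncate N t = t := by
  rw [abs_le] at h
  rw [truncate, max_eq_left h.1, min_eq_left h.2]

theorem continuous_truncate (N : ℝ) : Continuous (truncate N) := by
  unfold truncate; fun_prop

/-- If `h` is, in `L¹`, a fixed vector of a Markov operator which preserves `μ`, then the operator
also preserves the measures with density a truncation of `h`. -/
theorem integral_truncate_mul_apply (hP : IsRealMarkov P)
    (hμ : ∀ u : C(K, ℝ), ∫ x, P u x ∂(μ : Measure K) = ∫ x, u x ∂(μ : Measure K))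
    {h : K → ℝ} (hh : Integrable h (μ : Measure K)) (u : ℕ → C(K, ℝ))
    (hu : Filter.Tendsto (fun n => ∫ x, |u n x - h x| ∂(μ : Measure K)) Filter.atTop (𝓝 0))
    (hd : Filter.Tendsto (fun n => defect P μ (u n)) Filter.atTop (𝓝 0))
    {N : ℝ} (hN : 0 ≤ N) (g : C(K, ℝ)) :
    ∫ x, truncate N (h x) * P g x ∂(μ : Measure K) =
      ∫ x, truncate N (h x) * g x ∂(μ : Measure K) := by
  set w : ℕ → C(K, ℝ) := fun n => (u n ⊔ ContinuousMap.const K (-N)) ⊓ ContinuousMap.const K N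
  have hwx : ∀ n x, w n x = truncate N (u n x) := fun n x => by simp [w, truncate]
  -- Each of the two one-sided truncations at most doubles the defect, whence the factor 4.
  have hwd : Filter.Tendsto (fun n => defect P μ (w n)) Filter.atTop (𝓝 0) := by
    refine squeeze_zero (fun n => integral_nonneg fun x => abs_nonneg _)
      (g := fun n => 4 * defect P μ (u n)) (fun n => ?_) (by simpa using hd.const_mul 4)
    have h1 := hP.defect_inf_const_le hμ (u n ⊔ ContinuousMap.const K (-N)) N
    have h2 := hP.defect_sup_const_le hμ (u n) (-N)
    simp only [w]
    linarith
  have htr : ∀ v : C(K, ℝ), Filter.Tendsto (fun n => ∫ x, w n x * v x ∂(μ : Measure K))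
      Filter.atTop (𝓝 (∫ x, truncate N (h x) * v x ∂(μ : Measure K))) := by
    intro v
    have hti : Integrable (fun x => truncate N (h x) * v x) (μ : Measure K) := by
      refine (hh.abs.mul_const ‖v‖).mono'
        (((continuous_truncate N).comp_aestronglyMeasurable hh.1).mul
          (integrable_real μ v).1) (.of_forall fun x => ?_)
      rw [norm_mul]
      gcongr
      · have := abs_truncate_sub_le N (h x) 0
        rwa [truncate_eq_self (t := 0) (by simpa using hN), sub_zero, sub_zero] at this
      · exact v.norm_coe_le_norm x
    rw [tendsto_iff_norm_sub_tendsto_zero]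
    refine squeeze_zero (fun n => norm_nonneg _)
      (g := fun n => (∫ x, |u n x - h x| ∂(μ : Measure K)) * ‖v‖) (fun n => ?_)
      (by simpa using hu.mul_const ‖v‖)
    have e := integral_sub (integrable_real μ (w n * v)) hti
    simp only [ContinuousMap.mul_apply] at e
    rw [← e, ← integral_mul_const]
    have hi : Integrable (fun x => |u n x - h x| * ‖v‖) (μ : Measure K) :=
      (((integrable_real μ (u n)).sub hh).abs).mul_const _
    refine norm_integral_le_of_norm_le hi (.of_forall fun x => ?_)
    rw [← sub_mul, norm_mul, hwx]
    gcongr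
    · exact abs_truncate_sub_le _ _ _
    · exact v.norm_coe_le_norm x
  have hlim := ((htr (P g)).sub (htr g)).abs
  have hle : ∀ ε : ℝ, 0 < ε → |∫ x, truncate N (h x) * P g x ∂(μ : Measure K) -
      ∫ x, truncate N (h x) * g x ∂(μ : Measure K)| ≤ ‖g‖ * ε := by
    intro ε hε
    -- The limit in `n` is taken with `ε` fixed, which removes the term with `1 / ε`; only then does
    -- `ε` tend to zero.
    have h2 : Filter.Tendsto (fun n => ‖g‖ * (ε + 2 * N * defect P μ (w n) / (4 * ε)))
        Filter.atTop (𝓝 (‖g‖ * ε)) := by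
      have := (((hwd.const_mul (2 * N)).div_const (4 * ε)).const_add ε).const_mul ‖g‖
      simpa using this
    refine le_of_tendsto_of_tendsto' hlim h2 fun n => ?_
    exact hP.abs_integral_mul_apply_sub_le hμ (w n) g
      (fun x => by rw [hwx]; exact abs_truncate_le hN _) hε
  rw [← sub_eq_zero, ← abs_nonpos_iff]
  have h3 : Filter.Tendsto (fun ε : ℝ => ‖g‖ * ε) (𝓝[>] 0) (𝓝 0) := by
    have : Filter.Tendsto (fun ε : ℝ => ‖g‖ * ε) (𝓝 0) (𝓝 (‖g‖ * 0)) :=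
      (continuous_const.mul continuous_id).tendsto 0
    rw [mul_zero] at this
    exact this.mono_left nhdsWithin_le_nhds
  exact ge_of_tendsto h3 (Filter.eventually_of_mem self_mem_nhdsWithin fun ε hε => hle ε hε)

end IsRealMarkov

end RealMarkov

/-! ### Reduction of complex Markov operators to real ones -/

section RealPart

variable {K : Type*} [TopologicalSpace K] [CompactSpace K]

/-- A real continuous function as a complex one. -/
def toComplex (u : C(K, ℝ)) : C(K, ℂ) := ⟨fun x => (u x : ℂ), by fun_prop⟩

/-- The real part of a continuous function. -/
def rePart (f : C(K, ℂ)) : C(K, ℝ) := ⟨fun x => (f x).re, by fun_prop⟩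

/-- The imaginary part of a continuous function. -/
def imPart (f : C(K, ℂ)) : C(K, ℝ) := ⟨fun x => (f x).im, by fun_prop⟩

/-- The modulus as a real continuous function. -/
def realModulus (f : C(K, ℂ)) : C(K, ℝ) := ⟨fun x => ‖f x‖, by fun_prop⟩

@[simp] theorem toComplex_apply (u : C(K, ℝ)) (x : K) : toComplex u x = (u x : ℂ) := rfl
@[simp] theorem rePart_apply (f : C(K, ℂ)) (x : K) : rePart f x = (f x).re := rfl
@[simp] theorem imPart_apply (f : C(K, ℂ)) (x : K) : imPart f x = (f x).im := rfl
@[simp] theorem realModulus_apply (f : C(K, ℂ)) (x : K) : realModulus f x = ‖f x‖ := rfl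
@[simp] theorem modulus_apply (f : C(K, ℂ)) (x : K) : modulus f x = (‖f x‖ : ℂ) := rfl

theorem toComplex_nonneg {u : C(K, ℝ)} (hu : 0 ≤ u) : 0 ≤ toComplex u := fun x => by
  change (0 : ℂ) ≤ (u x : ℂ)
  exact_mod_cast hu x

/-- The restriction of an operator to real functions, followed by the real part. -/
def realOp (T : C(K, ℂ) →L[ℂ] C(K, ℂ)) : C(K, ℝ) →ₗ[ℝ] C(K, ℝ) where
  toFun u := rePart (T (toComplex u))
  map_add' u v := by
    have : toComplex (u + v) = toComplex u + toComplex v := by ext; simp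
    ext x; simp [this]
  map_smul' c u := by
    have : toComplex (c • u) = (c : ℂ) • toComplex u := by ext; simp
    ext x; simp [this]

/-- Adding the constant `‖u‖` makes `u` nonnegative, and `T` maps that constant to itself. -/
theorem IsMarkov.im_apply_toComplex {T : C(K, ℂ) →L[ℂ] C(K, ℂ)} (hT : IsMarkov T) (u : C(K, ℝ))
    (x : K) : (T (toComplex u) x).im = 0 := by
  have h := hT.nonneg (toComplex (u + ‖u‖ • 1)) (toComplex_nonneg fun y => by
    have := (abs_le.1 (u.norm_coe_le_norm y)).1
    change (0 : ℝ) ≤ u y + ‖u‖ * 1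
    linarith)
  have e : toComplex (u + ‖u‖ • 1) = toComplex u + (‖u‖ : ℂ) • 1 := by ext; simp
  rw [e, map_add, map_smul, hT.map_one] at h
  have h2 := (Complex.nonneg_iff.1 (h x)).2
  simpa using h2.symm

theorem IsMarkov.apply_toComplex {T : C(K, ℂ) →L[ℂ] C(K, ℂ)} (hT : IsMarkov T) (u : C(K, ℝ)) :
    T (toComplex u) = toComplex (realOp T u) := by
  ext x
  refine Complex.ext ?_ ?_
  · simp [realOp]
  · simpa using hT.im_apply_toComplex u x

theorem toComplex_rePart_add (f : C(K, ℂ)) :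
    f = toComplex (rePart f) + Complex.I • toComplex (imPart f) := by
  ext x
  simp [mul_comm Complex.I]

theorem IsMarkov.apply_eq {T : C(K, ℂ) →L[ℂ] C(K, ℂ)} (hT : IsMarkov T) (f : C(K, ℂ)) :
    T f = toComplex (realOp T (rePart f)) + Complex.I • toComplex (realOp T (imPart f)) := by
  conv_lhs => rw [toComplex_rePart_add f]
  rw [map_add, map_smul, hT.apply_toComplex, hT.apply_toComplex]

theorem IsMarkov.realOp_rePart {T : C(K, ℂ) →L[ℂ] C(K, ℂ)} (hT : IsMarkov T) (f : C(K, ℂ))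
    (x : K) : realOp T (rePart f) x = (T f x).re := by
  rw [hT.apply_eq]; simp

theorem IsMarkov.realOp_imPart {T : C(K, ℂ) →L[ℂ] C(K, ℂ)} (hT : IsMarkov T) (f : C(K, ℂ))
    (x : K) : realOp T (imPart f) x = (T f x).im := by
  rw [hT.apply_eq]; simp

theorem IsMarkov.isRealMarkov {T : C(K, ℂ) →L[ℂ] C(K, ℂ)} (hT : IsMarkov T) :
    IsRealMarkov (realOp T) where
  nonneg u hu x := (Complex.nonneg_iff.1 (hT.nonneg _ (toComplex_nonneg hu) x)).1
  map_one := by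
    have : toComplex (1 : C(K, ℝ)) = 1 := by ext; simp
    ext x
    simp [realOp, this, hT.map_one]

theorem IsMarkov.norm_apply_le_of_forall_le {T : C(K, ℂ) →L[ℂ] C(K, ℂ)} (hT : IsMarkov T)
    {f : C(K, ℂ)} {c : ℝ} (h : ∀ x, ‖f x‖ ≤ c) (x : K) : ‖T f x‖ ≤ c := by
  have h1 := norm_apply_le hT f x
  have h2 := hT.isRealMarkov.mono (u := realModulus f) (v := ContinuousMap.const K c)
    (fun y => h y) x
  rw [hT.isRealMarkov.map_const] at h2
  exact h1.trans h2

variable [MeasurableSpace K] [BorelSpace K]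

theorem IsInvariantMeasure.integral_realOp {S : Subsemigroup (C(K, ℂ) →L[ℂ] C(K, ℂ))}
    (hS : ∀ T ∈ S, IsMarkov T) {μ : ProbabilityMeasure K} (hμ : IsInvariantMeasure S μ)
    {T : C(K, ℂ) →L[ℂ] C(K, ℂ)} (hT : T ∈ S) (u : C(K, ℝ)) :
    ∫ x, realOp T u x ∂(μ : Measure K) = ∫ x, u x ∂(μ : Measure K) := by
  have h := hμ.integral_eq T hT (toComplex u)
  rw [(hS T hT).apply_toComplex] at h
  simp only [toComplex_apply] at h
  rw [integral_complex_ofReal, integral_complex_ofReal] at h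
  exact_mod_cast h

theorem isInvariantMeasure_of_realOp {S : Subsemigroup (C(K, ℂ) →L[ℂ] C(K, ℂ))}
    (hS : ∀ T ∈ S, IsMarkov T) {μ : ProbabilityMeasure K} (hr : (μ : Measure K).Regular)
    (hμ : ∀ T ∈ S, ∀ u : C(K, ℝ),
      ∫ x, realOp T u x ∂(μ : Measure K) = ∫ x, u x ∂(μ : Measure K)) :
    IsInvariantMeasure S μ where
  regular := hr
  integral_eq T hT f := by
    have key : ∀ u v : C(K, ℝ), ∫ x, (toComplex u + Complex.I • toComplex v) x ∂(μ : Measure K) =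
        ((∫ x, u x ∂(μ : Measure K) : ℝ) : ℂ) +
          Complex.I * ((∫ x, v x ∂(μ : Measure K) : ℝ) : ℂ) := by
      intro u v
      have := integral_add (integrable_continuousMap μ (toComplex u))
        (integrable_continuousMap μ (Complex.I • toComplex v))
      refine this.trans ?_
      simp only [ContinuousMap.smul_apply, toComplex_apply, smul_eq_mul, integral_const_mul]
      rw [integral_complex_ofReal, integral_complex_ofReal]
    conv_rhs => rw [toComplex_rePart_add f]
    rw [(hS T hT).apply_eq, key, key, hμ T hT, hμ T hT]

end RealPart

/-! ### Invariant states -/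

section States

variable {K : Type*} [TopologicalSpace K] [CompactSpace K]

/-- The invariant states on `C(K, ℝ)` which annihilate the moduli of the elements of an ideal. -/
def invariantStates (S : Subsemigroup (C(K, ℂ) →L[ℂ] C(K, ℂ))) (I : Ideal C(K, ℂ)) :
    Set (WeakDual ℝ C(K, ℝ)) :=
  {φ | (∀ u : C(K, ℝ), 0 ≤ u → 0 ≤ φ u) ∧ φ 1 = 1 ∧
    (∀ T ∈ S, ∀ u : C(K, ℝ), φ (realOp T u) = φ u) ∧ ∀ f ∈ I, φ (realModulus f) = 0}

/-- All the conditions are weak* closed, and positivity with `φ 1 = 1` places the states in the dual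
unit ball, so Banach–Alaoglu applies. -/
theorem isCompact_invariantStates (S : Subsemigroup (C(K, ℂ) →L[ℂ] C(K, ℂ)))
    (I : Ideal C(K, ℂ)) : IsCompact (invariantStates S I) := by
  refine (WeakDual.isCompact_closedBall (𝕜 := ℝ) (E := C(K, ℝ)) 0 1).of_isClosed_subset ?_ ?_
  · have he : ∀ u : C(K, ℝ), Continuous fun φ : WeakDual ℝ C(K, ℝ) => φ u :=
      WeakDual.eval_continuous
    simp only [invariantStates, Set.ofPred_and, Set.ofPred_forall]
    refine .inter ?_ (.inter ?_ (.inter ?_ ?_))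
    · exact isClosed_iInter fun u => isClosed_iInter fun _ => isClosed_le continuous_const (he u)
    · exact isClosed_eq (he 1) continuous_const
    · exact isClosed_iInter fun T => isClosed_iInter fun _ => isClosed_iInter fun u =>
        isClosed_eq (he _) (he _)
    · exact isClosed_iInter fun f => isClosed_iInter fun _ => isClosed_eq (he _) continuous_const
  · rintro φ ⟨h0, h1, -, -⟩
    simp only [Set.mem_preimage, mem_closedBall_zero_iff]
    refine ContinuousLinearMap.opNorm_le_bound _ zero_le_one fun u => ?_
    change ‖φ u‖ ≤ 1 * ‖u‖
    have key : ∀ v : C(K, ℝ), φ v ≤ ‖v‖ := fun v => by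
      have := h0 (‖v‖ • 1 - v) fun x => by
        have := (abs_le.1 (v.norm_coe_le_norm x)).2
        change (0 : ℝ) ≤ ‖v‖ * 1 - v x
        linarith
      rw [map_sub, map_smul, h1] at this
      simpa using this
    rw [one_mul, Real.norm_eq_abs, abs_le]
    have := key (-u)
    rw [map_neg, norm_neg] at this
    exact ⟨by linarith, key u⟩

theorem invariantStates_nonempty [T2Space K] {S : Subsemigroup (C(K, ℂ) →L[ℂ] C(K, ℂ))}
    (hS : ∀ T ∈ S, IsMarkov T) (hA : IsRightAmenable S) {I : Ideal C(K, ℂ)} (hI : IsSIdeal S I) :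
    (invariantStates S I).Nonempty := by
  obtain ⟨m, hm0, hm1, hmS⟩ := hA
  obtain ⟨x, hx⟩ : (idealSupport I).Nonempty := by
    by_contra h
    rw [Set.not_nonempty_iff_eq_empty] at h
    refine hI.ne_top ((Ideal.eq_top_iff_one I).2 ((mem_iff_of_isClosed hI.isClosed _).2 ?_))
    simp [h]
  -- The mean is applied to the orbit of `u` evaluated at a common zero `x` of `I`, which is bounded
  -- by `‖u‖` and strongly continuous in `T`.
  let orbit : C(K, ℝ) → (StrongOp S →ᵇ ℂ) := fun u =>
    BoundedContinuousFunction.ofNormedAddCommGroup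
      (fun T : StrongOp S => (id (α := S) T).1 (toComplex u) x)
      ((continuous_eval_const x).comp ((continuous_apply (toComplex u)).comp continuous_induced_dom))
      ‖u‖ (fun T => (hS _ (id (α := S) T).2).norm_apply_le_of_forall_le
        (fun y => by simpa using u.norm_coe_le_norm y) x)
  let φ : StrongDual ℝ C(K, ℝ) := LinearMap.mkContinuous
    { toFun := fun u => (m (orbit u)).re
      map_add' := fun u v => by
        have : orbit (u + v) = orbit u + orbit v := by
          ext T
          have : toComplex (u + v) = toComplex u + toComplex v := by ext; simp
          change (id (α := S) T).1 (toComplex (u + v)) x = _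
          rw [this, map_add]; rfl
        rw [this, map_add, Complex.add_re]
      map_smul' := fun c u => by
        have : orbit (c • u) = (c : ℂ) • orbit u := by
          ext T
          have : toComplex (c • u) = (c : ℂ) • toComplex u := by ext; simp
          change (id (α := S) T).1 (toComplex (c • u)) x = _
          rw [this, map_smul]; rfl
        rw [this, map_smul]
        simp } ‖m‖ (fun u => by
          change |(m (orbit u)).re| ≤ _
          refine (Complex.abs_re_le_norm _).trans ((m.le_opNorm _).trans ?_)
          gcongr
          exact BoundedContinuousFunction.norm_ofNormedAddCommGroup_le _ (norm_nonneg _) _)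
  have φ_apply : ∀ u, φ u = (m (orbit u)).re := fun u => rfl
  refine ⟨StrongDual.toWeakDual φ, ?_, ?_, ?_, ?_⟩
  · intro u hu
    change 0 ≤ φ u
    rw [φ_apply]
    refine (Complex.nonneg_iff.1 (hm0 _ fun T => ?_)).1
    exact (hS _ (id (α := S) T).2).nonneg _ (toComplex_nonneg hu) x
  · change φ 1 = 1
    have : orbit 1 = BoundedContinuousFunction.const _ 1 := by
      ext T
      have h1 : toComplex (1 : C(K, ℝ)) = 1 := by ext; simp
      change (id (α := S) T).1 (toComplex 1) x = 1
      rw [h1, (hS _ (id (α := S) T).2).map_one]; rfl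
    rw [φ_apply, this, hm1, Complex.one_re]
  · intro T hT u
    change φ _ = φ _
    -- The orbit function of `T u` is the right translate by `T` of that of `u`; this is where right
    -- amenability enters.
    rw [φ_apply, φ_apply, ← hmS ⟨T, hT⟩ (orbit u)]
    congr 2
    ext R
    change (id (α := S) R).1 (toComplex (realOp T u)) x = (id (α := S) R).1 (T (toComplex u)) x
    rw [(hS T hT).apply_toComplex]
  · intro f hf
    change φ _ = 0
    -- The modulus of `f` lies in `I`, hence so do all its images, and these vanish at `x`.
    have : orbit (realModulus f) = 0 := by
      ext T
      refine hx _ (hI.invariant _ (id (α := S) T).2 _ ((mem_iff_of_isClosed hI.isClosed _).2 ?_))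
      intro y hy
      simpa using hy f hf
    rw [φ_apply, this, map_zero, Complex.zero_re]

variable [MeasurableSpace K] [BorelSpace K]

/-- Riesz–Markov–Kakutani for states on `C(K, ℝ)`. -/
theorem exists_probabilityMeasure_integral_eq [T2Space K] (φ : WeakDual ℝ C(K, ℝ))
    (h0 : ∀ u : C(K, ℝ), 0 ≤ u → 0 ≤ φ u) (h1 : φ 1 = 1) :
    ∃ μ : ProbabilityMeasure K, (μ : Measure K).Regular ∧
      ∀ u : C(K, ℝ), ∫ x, u x ∂(μ : Measure K) = φ u := by
  let Λ : CompactlySupportedContinuousMap K ℝ →ₚ[ℝ] ℝ := PositiveLinearMap.mk₀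
    { toFun := fun u => φ u.toContinuousMap
      map_add' := fun u v => map_add φ _ _
      map_smul' := fun c u => map_smul φ _ _ } fun u hu => h0 _ fun x => hu x
  have hΛ : ∀ u : C(K, ℝ), ∫ x, u x ∂(RealRMK.rieszMeasure Λ) = φ u := fun u =>
    RealRMK.integral_rieszMeasure Λ (CompactlySupportedContinuousMap.continuousMapEquiv u)
  have hp : IsProbabilityMeasure (RealRMK.rieszMeasure Λ) := by
    have hfin : IsFiniteMeasure (RealRMK.rieszMeasure Λ) := inferInstance
    have := hΛ 1
    rw [h1] at this
    simp only [ContinuousMap.one_apply, integral_const, smul_eq_mul, mul_one] at this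
    refine ⟨?_⟩
    rwa [Measure.real, ENNReal.toReal_eq_one_iff] at this
  exact ⟨⟨_, hp⟩, inferInstanceAs (RealRMK.rieszMeasure Λ).Regular, hΛ⟩

end States

/-! ### Extreme invariant states and ergodicity -/

section Extreme

variable {K : Type*} [TopologicalSpace K] [CompactSpace K] [T2Space K]
  [MeasurableSpace K] [BorelSpace K]

/-- Since `w` is orthogonal to every continuous `g`, `∫ w² = ∫ w (w - g) ≤ C ‖w - g‖₁`, and
continuous functions are dense in `L¹`. -/
theorem ae_eq_zero_of_integral_mul_continuousMap_eq_zero {μ : ProbabilityMeasure K}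
    (hr : (μ : Measure K).Regular) {w : K → ℝ} (hw : Integrable w (μ : Measure K)) {C : ℝ}
    (hC : ∀ x, |w x| ≤ C) (h : ∀ g : C(K, ℝ), ∫ x, w x * g x ∂(μ : Measure K) = 0) :
    w =ᵐ[(μ : Measure K)] 0 := by
  have hww : Integrable (fun x => w x * w x) (μ : Measure K) :=
    hw.bdd_mul hw.1 (.of_forall hC)
  have hle : ∀ ε : ℝ, 0 < ε → ∫ x, w x * w x ∂(μ : Measure K) ≤ C * ε := by
    intro ε hε
    obtain ⟨g, hg, hgi⟩ := hw.exists_boundedContinuous_integral_sub_le hε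
    have hwg : Integrable (fun x => w x * g x) (μ : Measure K) := hgi.bdd_mul hw.1 (.of_forall hC)
    have h0 : ∫ x, w x * g x ∂(μ : Measure K) = 0 := h g.toContinuousMap
    have e : ∫ x, w x * w x ∂(μ : Measure K) = ∫ x, w x * (w x - g x) ∂(μ : Measure K) := by
      simp only [mul_sub]
      rw [integral_sub hww hwg, h0, sub_zero]
    rw [e]
    have hC0 : 0 ≤ C ∨ IsEmpty K := by
      rcases isEmpty_or_nonempty K with hK | ⟨⟨x⟩⟩
      · exact .inr hK
      · exact .inl ((abs_nonneg _).trans (hC x))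
    rcases hC0 with hC0 | hK
    · calc ∫ x, w x * (w x - g x) ∂(μ : Measure K)
          ≤ ∫ x, C * ‖w x - g x‖ ∂(μ : Measure K) := by
            refine integral_mono ((hw.sub hgi).bdd_mul hw.1 (.of_forall hC))
              ((hw.sub hgi).norm.const_mul C) fun x => ?_
            refine (le_abs_self _).trans ?_
            simp only [abs_mul]
            exact mul_le_mul_of_nonneg_right (hC x) (abs_nonneg _)
        _ ≤ C * ε := by rw [integral_const_mul]; gcongr
    · have : (μ : Measure K) = 0 := Measure.eq_zero_of_isEmpty _
      exact absurd this (IsProbabilityMeasure.ne_zero _)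
  have h0 : ∫ x, w x * w x ∂(μ : Measure K) = 0 := by
    refine le_antisymm ?_ (integral_nonneg fun x => mul_self_nonneg _)
    have h3 : Filter.Tendsto (fun ε : ℝ => C * ε) (𝓝[>] 0) (𝓝 0) := by
      have : Filter.Tendsto (fun ε : ℝ => C * ε) (𝓝 0) (𝓝 (C * 0)) :=
        (continuous_const.mul continuous_id).tendsto 0
      rw [mul_zero] at this
      exact this.mono_left nhdsWithin_le_nhds
    exact ge_of_tendsto h3 (Filter.eventually_of_mem self_mem_nhdsWithin fun ε hε => hle ε hε)
  rw [integral_eq_zero_iff_of_nonneg (fun x => mul_self_nonneg _) hww] at h0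
  filter_upwards [h0] with x hx
  simpa using hx

/-- The functional on `C(K, ℝ)` given by an integrable density. -/
theorem exists_dual_eq_integral_mul (μ : ProbabilityMeasure K) {ρ : K → ℝ}
    (hρ : Integrable ρ (μ : Measure K)) :
    ∃ θ : WeakDual ℝ C(K, ℝ), ∀ u, θ u = ∫ x, ρ x * u x ∂(μ : Measure K) := by
  have hi : ∀ u : C(K, ℝ), Integrable (fun x => ρ x * u x) (μ : Measure K) := fun u =>
    hρ.mul_bdd (c := ‖u‖) (integrable_real μ u).1 (.of_forall fun x => u.norm_coe_le_norm x)
  refine ⟨StrongDual.toWeakDual (LinearMap.mkContinuous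
    { toFun := fun u => ∫ x, ρ x * u x ∂(μ : Measure K)
      map_add' := fun u v => by
        rw [← integral_add (hi u) (hi v)]
        simp [mul_add]
      map_smul' := fun c u => by
        simp only [RingHom.id_apply, smul_eq_mul]
        rw [← integral_const_mul]
        simp [mul_left_comm] } (∫ x, |ρ x| ∂(μ : Measure K)) fun u => ?_), fun u => rfl⟩
  change ‖∫ x, ρ x * u x ∂(μ : Measure K)‖ ≤ _
  rw [← integral_mul_const]
  refine norm_integral_le_of_norm_le (hρ.abs.mul_const _) (.of_forall fun x => ?_)
  rw [norm_mul]
  exact mul_le_mul_of_nonneg_left (u.norm_coe_le_norm x) (norm_nonneg _)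

variable {S : Subsemigroup (C(K, ℂ) →L[ℂ] C(K, ℂ))} {I : Ideal C(K, ℂ)}
  {φ : WeakDual ℝ C(K, ℝ)} {μ : ProbabilityMeasure K}

/-- The bound `ρ ≤ 2` keeps the new state inside the set attached to `I`, through `∫ ρ |f| ≤ 2 ∫ |f|
= 0`. Thus extremality among the states annihilating `I` is enough for ergodicity. -/
theorem mem_invariantStates_of_density (hφ : φ ∈ invariantStates S I)
    (hμ : ∀ u : C(K, ℝ), ∫ x, u x ∂(μ : Measure K) = φ u) {ρ : K → ℝ}
    (hρ : Integrable ρ (μ : Measure K)) (h0 : ∀ x, 0 ≤ ρ x) (h2 : ∀ x, ρ x ≤ 2)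
    (h1 : ∫ x, ρ x ∂(μ : Measure K) = 1)
    (hinv : ∀ T ∈ S, ∀ u : C(K, ℝ),
      ∫ x, ρ x * realOp T u x ∂(μ : Measure K) = ∫ x, ρ x * u x ∂(μ : Measure K))
    {θ : WeakDual ℝ C(K, ℝ)} (hθ : ∀ u, θ u = ∫ x, ρ x * u x ∂(μ : Measure K)) :
    θ ∈ invariantStates S I := by
  refine ⟨fun u hu => ?_, ?_, fun T hT u => ?_, fun f hf => ?_⟩
  · rw [hθ]
    exact integral_nonneg fun x => mul_nonneg (h0 x) (hu x)
  · simpa [hθ] using h1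
  · rw [hθ, hθ, hinv T hT]
  · rw [hθ]
    refine le_antisymm ?_ (integral_nonneg fun x => mul_nonneg (h0 x) (norm_nonneg (f x)))
    have hf0 : ∫ x, realModulus f x ∂(μ : Measure K) = 0 := by rw [hμ, hφ.2.2.2 f hf]
    calc ∫ x, ρ x * realModulus f x ∂(μ : Measure K)
        ≤ ∫ x, 2 * realModulus f x ∂(μ : Measure K) :=
          integral_mono (hρ.mul_bdd (c := ‖realModulus f‖) (integrable_real μ _).1
            (.of_forall fun x => (realModulus f).norm_coe_le_norm x))
            ((integrable_real μ _).const_mul 2)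
            fun x => mul_le_mul_of_nonneg_right (h2 x) (norm_nonneg (f x))
      _ = 0 := by rw [integral_const_mul, hf0, mul_zero]

open IsRealMarkov in
-- A nonconstant invariant bounded density would split `φ`: it is the midpoint of the states with
-- densities `1 ± s (t - a)`. Extremality makes both equal to `φ`, so `t - a` is orthogonal to all
-- continuous functions.
theorem truncate_ae_eq_const (hφ : φ ∈ (invariantStates S I).extremePoints ℝ)
    (hr : (μ : Measure K).Regular) (hμ : ∀ u : C(K, ℝ), ∫ x, u x ∂(μ : Measure K) = φ u)
    {h : K → ℝ} (hh : Integrable h (μ : Measure K)) {N : ℝ} (hN : 0 < N)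
    (hinv : ∀ T ∈ S, ∀ g : C(K, ℝ), ∫ x, truncate N (h x) * realOp T g x ∂(μ : Measure K) =
      ∫ x, truncate N (h x) * g x ∂(μ : Measure K)) :
    ∃ c : ℝ, ∀ᵐ x ∂(μ : Measure K), truncate N (h x) = c := by
  have hφ' := hφ.1
  set t : K → ℝ := fun x => truncate N (h x) with ht
  have htN : ∀ x, |t x| ≤ N := fun x => abs_truncate_le hN.le _
  have hti : Integrable t (μ : Measure K) := by
    refine (integrable_const N).mono' ((continuous_truncate N).comp_aestronglyMeasurable hh.1)
      (.of_forall fun x => htN x)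
  obtain ⟨a, ha⟩ : ∃ a : ℝ, a = ∫ x, t x ∂(μ : Measure K) := ⟨_, rfl⟩
  have haN : |a| ≤ N := by
    have := norm_integral_le_of_norm_le (f := t) (integrable_const (μ := (μ : Measure K)) N)
      (.of_forall fun x => htN x)
    simpa [ha] using this
  have hinv' : ∀ s : ℝ, ∀ T ∈ S, ∀ u : C(K, ℝ),
      ∫ x, (1 + s * (t x - a)) * realOp T u x ∂(μ : Measure K) =
      ∫ x, (1 + s * (t x - a)) * u x ∂(μ : Measure K) := by
    intro s T hT u
    have key : ∀ v : C(K, ℝ), ∫ x, (1 + s * (t x - a)) * v x ∂(μ : Measure K) =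
        (1 - s * a) * φ v + s * ∫ x, t x * v x ∂(μ : Measure K) := fun v => by
      rw [← hμ, ← integral_const_mul, ← integral_const_mul, ← integral_add]
      · refine integral_congr_ae (.of_forall fun x => ?_)
        simp only; ring
      · exact (integrable_real μ v).const_mul _
      · exact (((integrable_real μ v).bdd_mul hti.1 (.of_forall htN))).const_mul _
    rw [key, key, hinv T hT, hφ'.2.2.1 T hT]
  have hρi : ∀ s : ℝ, Integrable (fun x => 1 + s * (t x - a)) (μ : Measure K) := fun s =>
    (integrable_const _).add ((hti.sub (integrable_const _)).const_mul s)
  have hρ1 : ∀ s : ℝ, ∫ x, (1 + s * (t x - a)) ∂(μ : Measure K) = 1 := fun s => by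
    have h1 := integral_add (integrable_const (μ := (μ : Measure K)) (1 : ℝ))
      ((hti.sub (integrable_const a)).const_mul s)
    refine h1.trans ?_
    have h2 := integral_sub hti (integrable_const a)
    rw [integral_const_mul]
    simp only [Pi.sub_apply] at h2 ⊢
    rw [h2, ← ha]
    simp
  -- As `|t - a| ≤ 2N`, this size of `s` keeps the densities in `[0, 2]`.
  have hb : ∀ s : ℝ, |s| = 1 / (2 * N) → ∀ x, |s * (t x - a)| ≤ 1 := fun s hs x => by
    rw [abs_mul, hs]
    have : |t x - a| ≤ 2 * N := (abs_sub _ _).trans (by linarith [htN x])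
    calc 1 / (2 * N) * |t x - a| ≤ 1 / (2 * N) * (2 * N) := by gcongr
      _ = 1 := by field_simp
  have hmem : ∀ s : ℝ, |s| = 1 / (2 * N) → ∃ θ ∈ invariantStates S I,
      ∀ u : C(K, ℝ), θ u = ∫ x, (1 + s * (t x - a)) * u x ∂(μ : Measure K) := fun s hs => by
    obtain ⟨θ, hθ⟩ := exists_dual_eq_integral_mul μ (hρi s)
    refine ⟨θ, mem_invariantStates_of_density hφ' hμ (hρi s) (fun x => ?_) (fun x => ?_) (hρ1 s)
      (hinv' s) hθ, hθ⟩
    · linarith [(abs_le.1 (hb s hs x)).1]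
    · linarith [(abs_le.1 (hb s hs x)).2]
  have hs0 : |1 / (2 * N)| = 1 / (2 * N) := abs_of_pos (by positivity)
  obtain ⟨θ, hθm, hθ⟩ := hmem (1 / (2 * N)) hs0
  obtain ⟨θ', hθm', hθ'⟩ := hmem (-(1 / (2 * N))) (by rw [abs_neg, hs0])
  have hvi : ∀ u : C(K, ℝ), Integrable (fun x => (t x - a) * u x) (μ : Measure K) := fun u =>
    (hti.sub (integrable_const _)).mul_bdd (c := ‖u‖) (integrable_real μ u).1
      (.of_forall fun x => u.norm_coe_le_norm x)
  have hsplit : ∀ s : ℝ, ∀ u : C(K, ℝ), ∫ x, (1 + s * (t x - a)) * u x ∂(μ : Measure K) =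
      φ u + s * ∫ x, (t x - a) * u x ∂(μ : Measure K) := fun s u => by
    rw [← hμ, ← integral_const_mul, ← integral_add (integrable_real μ u) ((hvi u).const_mul s)]
    refine integral_congr_ae (.of_forall fun x => ?_)
    simp only; ring
  have hseg : φ ∈ openSegment ℝ θ θ' := by
    refine ⟨1 / 2, 1 / 2, by norm_num, by norm_num, by norm_num, ?_⟩
    refine DFunLike.ext _ _ fun u => ?_
    change (1 / 2 : ℝ) * θ u + (1 / 2 : ℝ) * θ' u = φ u
    rw [hθ, hθ', hsplit, hsplit]
    ring
  have heq : θ = φ := hφ.2 hθm hθm' hseg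
  have hzero : ∀ u : C(K, ℝ), ∫ x, (t x - a) * u x ∂(μ : Measure K) = 0 := fun u => by
    have h1 := hθ u
    rw [heq, hsplit] at h1
    have h2 : (1 / (2 * N)) * ∫ x, (t x - a) * u x ∂(μ : Measure K) = 0 := by linarith
    exact (mul_eq_zero.1 h2).resolve_left (by positivity)
  have h0 := ae_eq_zero_of_integral_mul_continuousMap_eq_zero hr (hti.sub (integrable_const a))
    (C := 2 * N) (fun x => (abs_sub _ _).trans (by linarith [htN x])) hzero
  refine ⟨a, ?_⟩
  filter_upwards [h0] with x hx
  simpa [sub_eq_zero] using hx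

open IsRealMarkov in
-- Outside one null set all integer truncations of `h` are constant. Two values of `h` are then
-- equal, because a truncation beyond both of them leaves them unchanged.
theorem ae_eq_const_of_extreme (hφ : φ ∈ (invariantStates S I).extremePoints ℝ)
    (hr : (μ : Measure K).Regular) (hμ : ∀ u : C(K, ℝ), ∫ x, u x ∂(μ : Measure K) = φ u)
    {h : K → ℝ} (hh : Integrable h (μ : Measure K))
    (hinv : ∀ N : ℝ, 0 ≤ N → ∀ T ∈ S, ∀ g : C(K, ℝ),
      ∫ x, truncate N (h x) * realOp T g x ∂(μ : Measure K) =
      ∫ x, truncate N (h x) * g x ∂(μ : Measure K)) :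
    ∃ c : ℝ, ∀ᵐ x ∂(μ : Measure K), h x = c := by
  have h1 : ∀ n : ℕ, ∃ c : ℝ, ∀ᵐ x ∂(μ : Measure K), truncate (n + 1) (h x) = c := fun n =>
    truncate_ae_eq_const hφ hr hμ hh (by positivity) (hinv _ (by positivity))
  choose c hc using h1
  have hall := ae_all_iff.2 hc
  obtain ⟨y, hy⟩ := hall.exists
  refine ⟨h y, ?_⟩
  filter_upwards [hall] with x hx
  obtain ⟨n, hn⟩ := exists_nat_ge (max |h x| |h y|)
  have e := (hx n).trans (hy n).symm
  have h2 := le_max_left |h x| |h y|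
  have h3 := le_max_right |h x| |h y|
  rwa [truncate_eq_self (by linarith), truncate_eq_self (by linarith)] at e

theorem norm_toLp_eq (μ : ProbabilityMeasure K) (g : C(K, ℂ)) :
    ‖ContinuousMap.toLp 1 (μ : Measure K) ℂ g‖ = ∫ x, ‖g x‖ ∂(μ : Measure K) := by
  rw [L1.norm_eq_integral_norm]
  refine integral_congr_ae ?_
  filter_upwards [ContinuousMap.coeFn_toLp (p := 1) (𝕜 := ℂ) (μ : Measure K) g] with x hx
  rw [hx]

theorem norm_toLp_sub_eq (μ : ProbabilityMeasure K) (g : C(K, ℂ)) (h : Lp ℂ 1 (μ : Measure K)) :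
    ‖ContinuousMap.toLp 1 (μ : Measure K) ℂ g - h‖ = ∫ x, ‖g x - h x‖ ∂(μ : Measure K) := by
  rw [L1.norm_eq_integral_norm]
  refine integral_congr_ae ?_
  filter_upwards [ContinuousMap.coeFn_toLp (p := 1) (𝕜 := ℂ) (μ : Measure K) g,
    Lp.coeFn_sub (ContinuousMap.toLp 1 (μ : Measure K) ℂ g) h] with x hx hx'
  rw [hx', Pi.sub_apply, hx]

/-- The class of the constant function one is a nonzero fixed vector in `L¹`. -/
theorem toLp_one_ne_zero (μ : ProbabilityMeasure K) :
    ContinuousMap.toLp 1 (μ : Measure K) ℂ (1 : C(K, ℂ)) ≠ 0 := by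
  rw [← norm_ne_zero_iff, norm_toLp_eq]
  simp

/-- The common fixed space in `L¹(K, μ)`. -/
abbrev lOneFixedSpace (S : Subsemigroup (C(K, ℂ) →L[ℂ] C(K, ℂ))) (μ : ProbabilityMeasure K) :
    Submodule ℂ (Lp ℂ 1 (μ : Measure K)) :=
  fixedSpace {R : Lp ℂ 1 (μ : Measure K) →ₗ[ℂ] Lp ℂ 1 (μ : Measure K) |
      ∃ T ∈ S, R = (lOneOp μ T).toLinearMap}

theorem mem_lOneFixedSpace {h : Lp ℂ 1 (μ : Measure K)} :
    h ∈ lOneFixedSpace S μ ↔ ∀ T ∈ S, lOneOp μ T h = h := by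
  constructor
  · intro hh T hT
    exact hh _ ⟨T, hT, rfl⟩
  · rintro hh _ ⟨T, hT, rfl⟩
    exact hh T hT

theorem toLp_one_mem (hS : ∀ T ∈ S, IsMarkov T) (hμ : IsInvariantMeasure S μ) :
    ContinuousMap.toLp 1 (μ : Measure K) ℂ (1 : C(K, ℂ)) ∈ lOneFixedSpace S μ :=
  mem_lOneFixedSpace.2 fun T hT => by rw [lOneOp_toLp hμ hT (hS T hT), (hS T hT).map_one]

theorem exists_approx (hr : (μ : Measure K).Regular) (h : Lp ℂ 1 (μ : Measure K)) :
    ∃ f : ℕ → C(K, ℂ), Filter.Tendsto (fun n => ContinuousMap.toLp 1 (μ : Measure K) ℂ (f n))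
      Filter.atTop (𝓝 h) := by
  have hdense : DenseRange (ContinuousMap.toLp 1 (μ : Measure K) ℂ :
      C(K, ℂ) →L[ℂ] Lp ℂ 1 (μ : Measure K)) :=
    ContinuousMap.toLp_denseRange ℂ (μ : Measure K) ℂ ENNReal.one_ne_top
  obtain ⟨s, hs, hsl⟩ := mem_closure_iff_seq_limit.1 (hdense h)
  choose f hf using hs
  refine ⟨f, ?_⟩
  simpa only [hf] using hsl

open IsRealMarkov in
/-- Extreme invariant states are given by ergodic measures. -/
theorem isErgodicMeasure_of_extreme (hS : ∀ T ∈ S, IsMarkov T)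
    (hφ : φ ∈ (invariantStates S I).extremePoints ℝ)
    (hr : (μ : Measure K).Regular) (hμ : ∀ u : C(K, ℝ), ∫ x, u x ∂(μ : Measure K) = φ u) :
    IsErgodicMeasure S μ := by
  have hreal : ∀ T ∈ S, ∀ u : C(K, ℝ),
      ∫ x, realOp T u x ∂(μ : Measure K) = ∫ x, u x ∂(μ : Measure K) := fun T hT u => by
    rw [hμ, hμ, hφ.1.2.2.1 T hT]
  have hinv : IsInvariantMeasure S μ := isInvariantMeasure_of_realOp hS hr hreal
  refine ⟨hinv, ?_⟩
  refine finrank_eq_one_iff'.2 ⟨⟨_, toLp_one_mem hS hinv⟩, ?_, ?_⟩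
  · intro h
    exact toLp_one_ne_zero μ (congrArg Subtype.val h)
  rintro ⟨h, hh⟩
  have hfix := mem_lOneFixedSpace.1 hh
  have hhi : Integrable h (μ : Measure K) := L1.integrable_coeFn h
  obtain ⟨f, hf⟩ := exists_approx hr h
  have hf1 : Filter.Tendsto (fun n => ∫ x, ‖f n x - h x‖ ∂(μ : Measure K)) Filter.atTop (𝓝 0) := by
    rw [tendsto_iff_norm_sub_tendsto_zero] at hf
    simpa only [norm_toLp_sub_eq] using hf
  have hf2 : ∀ T ∈ S, Filter.Tendsto (fun n => ∫ x, ‖T (f n) x - f n x‖ ∂(μ : Measure K))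
      Filter.atTop (𝓝 0) := fun T hT => by
    have h1 := ((lOneOp μ T).continuous.tendsto h).comp hf
    rw [hfix T hT] at h1
    have h2 := (h1.sub hf).norm
    rw [sub_self, norm_zero] at h2
    refine h2.congr fun n => ?_
    simp only [Function.comp_apply]
    rw [lOneOp_toLp hinv hT (hS T hT), ← map_sub, norm_toLp_eq]
    rfl
  -- Real and imaginary parts are handled together: all that matters is that `q` is 1-Lipschitz and
  -- commutes with `T`, so that `L¹` approximations and their defects survive.
  have hconst : ∀ (part : C(K, ℂ) → C(K, ℝ)) (q : ℂ → ℝ), (∀ f x, part f x = q (f x)) →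
      (∀ a b, |q a - q b| ≤ ‖a - b‖) → Integrable (fun x => q (h x)) (μ : Measure K) →
      (∀ T ∈ S, ∀ f x, realOp T (part f) x = q (T f x)) →
      ∃ c : ℝ, ∀ᵐ x ∂(μ : Measure K), q (h x) = c := by
    intro part q hpart hq hqi hT'
    refine ae_eq_const_of_extreme hφ hr hμ hqi fun N hN T hT g => ?_
    refine (hS T hT).isRealMarkov.integral_truncate_mul_apply (hreal T hT) hqi
      (fun n => part (f n)) ?_ ?_ hN g
    · refine squeeze_zero (fun n => integral_nonneg fun x => abs_nonneg _) (fun n => ?_) hf1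
      refine integral_mono (((integrable_real μ _).sub hqi).abs)
        ((integrable_continuousMap μ (f n)).sub hhi).norm fun x => ?_
      simp only [hpart]
      exact hq _ _
    · refine squeeze_zero (fun n => integral_nonneg fun x => abs_nonneg _) (fun n => ?_) (hf2 T hT)
      refine integral_mono (((integrable_real μ _).sub (integrable_real μ _)).abs)
        ((integrable_continuousMap μ (T (f n))).sub (integrable_continuousMap μ (f n))).norm
        fun x => ?_
      simp only [hT' T hT, hpart]
      exact hq _ _
  obtain ⟨a, ha⟩ := hconst rePart Complex.re (fun _ _ => rfl)
    (fun a b => by rw [← Complex.sub_re]; exact Complex.abs_re_le_norm _) hhi.re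
    (fun T hT f x => (hS T hT).realOp_rePart f x)
  obtain ⟨b, hb⟩ := hconst imPart Complex.im (fun _ _ => rfl)
    (fun a b => by rw [← Complex.sub_im]; exact Complex.abs_im_le_norm _) hhi.im
    (fun T hT f x => (hS T hT).realOp_imPart f x)
  refine ⟨⟨a, b⟩, ?_⟩
  ext1
  change (⟨a, b⟩ : ℂ) • ContinuousMap.toLp 1 (μ : Measure K) ℂ (1 : C(K, ℂ)) = h
  rw [← map_smul]
  refine Lp.ext ?_
  filter_upwards [ha, hb, ContinuousMap.coeFn_toLp (p := 1) (𝕜 := ℂ) (μ : Measure K)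
    ((⟨a, b⟩ : ℂ) • (1 : C(K, ℂ)))] with x h1 h2 h3
  rw [h3]
  refine Complex.ext ?_ ?_
  · simp [h1]
  · simp [h2]

/-- Every proper closed invariant ideal is contained in the absolute kernel of an ergodic
measure. -/
theorem exists_isErgodicMeasure_le_absKernel (hS : ∀ T ∈ S, IsMarkov T) (hA : IsRightAmenable S)
    (hI : IsSIdeal S I) : ∃ μ : ProbabilityMeasure K, IsErgodicMeasure S μ ∧ I ≤ absKernel μ := by
  have : LocallyConvexSpace ℝ (WeakDual ℝ C(K, ℝ)) :=
    inferInstanceAs (LocallyConvexSpace ℝ (WeakBilin (topDualPairing ℝ C(K, ℝ))))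
  -- Krein–Milman in the weak* topology.
  obtain ⟨φ, hφ⟩ := (isCompact_invariantStates S I).extremePoints_nonempty
    (invariantStates_nonempty hS hA hI)
  obtain ⟨μ, hr, hμ⟩ := exists_probabilityMeasure_integral_eq φ hφ.1.1 hφ.1.2.1
  refine ⟨μ, isErgodicMeasure_of_extreme hS hφ hr hμ, fun f hf => ?_⟩
  exact (hμ (realModulus f)).trans (hφ.1.2.2.2 f hf)

end Extreme

/-! ### Closed invariant ideals and ergodic measures -/

section Ideals

variable {K : Type*} [TopologicalSpace K] [CompactSpace K] [T2Space K]
  {S : Subsemigroup (C(K, ℂ) →L[ℂ] C(K, ℂ))} {I J : Ideal C(K, ℂ)}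

/-- Urysohn's lemma separates a point outside `Z` from `Z`, so the ideal contains a function not
vanishing there. -/
theorem idealSupport_eq_of_mem_iff {Z : Set K} (hZ : IsClosed Z)
    (h : ∀ f, f ∈ I ↔ ∀ x ∈ Z, f x = 0) : idealSupport I = Z := by
  refine Set.Subset.antisymm (fun x hx => ?_) fun x hx f hf => (h f).1 hf x hx
  by_contra hxZ
  obtain ⟨u, hu0, hu1, -⟩ := exists_continuous_zero_one_of_isClosed hZ isClosed_singleton
    (Set.disjoint_singleton_right.2 hxZ)
  have := hx (toComplex u) ((h _).2 fun y hy => by simp [hu0 hy])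
  simp [hu1 (Set.mem_singleton x)] at this

theorem idealSupport_antitone (h : I ≤ J) : idealSupport J ⊆ idealSupport I :=
  fun _ hx f hf => hx f (h hf)

theorem idealSupport_nonempty (hI : IsClosed (I : Set C(K, ℂ))) (h : I ≠ ⊤) :
    (idealSupport I).Nonempty := by
  by_contra h'
  rw [Set.not_nonempty_iff_eq_empty] at h'
  refine h ((Ideal.eq_top_iff_one I).2 ((mem_iff_of_isClosed hI _).2 ?_))
  simp [h']

/-- If `f` is constant on the support of an invariant closed ideal, it is fixed there. -/
theorem apply_eq_self_of_const_on_idealSupport (hI : IsClosedInvariant S I)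
    {T : C(K, ℂ) →L[ℂ] C(K, ℂ)} (hT : T ∈ S) (hTM : IsMarkov T) {F : C(K, ℂ)}
    {c : ℂ} (hF : ∀ x ∈ idealSupport I, F x = c) {x : K} (hx : x ∈ idealSupport I) :
    T F x = c := by
  have := apply_eq_of_eqOn hI.isClosed (hI.invariant T hT) (F := F) (G := c • 1)
    (fun y => by simp [hF y y.2]) ⟨x, hx⟩
  simpa [hTM.map_one] using this

/-- If the supports of a family of invariant closed ideals have a common point, then the ideals
are contained in a common `S`-ideal. -/
theorem exists_isSIdeal_ge {ι : Sort*} {I : ι → Ideal C(K, ℂ)} (hI : ∀ i, IsClosedInvariant S (I i))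
    {x : K} (hx : ∀ i, x ∈ idealSupport (I i)) : ∃ J, IsSIdeal S J ∧ ∀ i, I i ≤ J := by
  have hsup : ∀ f ∈ ⨆ i, I i, f x = 0 := fun f hf => by
    refine Submodule.iSup_induction I (motive := fun f => f x = 0) hf
      (fun i f hf => hx i f hf) rfl fun _ _ hf hg => by simp [hf, hg]
  have hcl : ((⨆ i, I i).closure : Set C(K, ℂ)) = closure ((⨆ i, I i : Ideal C(K, ℂ)) : Set C(K, ℂ)) :=
    Ideal.coe_closure _
  have hle : (⨆ i, I i) ≤ (⨆ i, I i).closure := fun f hf => by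
    rw [← SetLike.mem_coe, hcl]
    exact subset_closure hf
  refine ⟨(⨆ i, I i).closure, ⟨⟨?_, ?_⟩, ?_⟩, fun i => (le_iSup I i).trans hle⟩
  · rw [hcl]; exact isClosed_closure
  · intro T hT f hf
    rw [← SetLike.mem_coe, hcl] at hf ⊢
    refine map_mem_closure T.continuous hf fun g hg => ?_
    refine Submodule.iSup_induction I (motive := fun g => T g ∈ ⨆ i, I i) hg
      (fun i g hg => le_iSup I i ((hI i).invariant T hT g hg)) ?_ fun g g' hg hg' => ?_
    · simp only [map_zero, Submodule.zero_mem]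
    · rw [map_add]; exact add_mem hg hg'
  -- Evaluation at `x` is continuous, so the closure of the sum still vanishes at `x` and cannot
  -- contain 1.
  · intro htop
    have h1 : (1 : C(K, ℂ)) ∈ (⨆ i, I i).closure := htop ▸ Submodule.mem_top
    rw [← SetLike.mem_coe, hcl] at h1
    have hc : IsClosed {f : C(K, ℂ) | f x = 0} :=
      isClosed_eq (continuous_eval_const x) continuous_const
    have := closure_minimal (fun f hf => hsup f hf) hc h1
    exact one_ne_zero this

variable [MeasurableSpace K] [BorelSpace K] {μ : ProbabilityMeasure K}

theorem mem_absKernel_iff_ae {f : C(K, ℂ)} :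
    f ∈ absKernel μ ↔ ∀ᵐ x ∂(μ : Measure K), f x = 0 := by
  change ∫ x, ‖f x‖ ∂(μ : Measure K) = 0 ↔ _
  rw [integral_eq_zero_iff_of_nonneg (fun x => norm_nonneg _) (integrable_continuousMap μ f).norm]
  simp [Filter.EventuallyEq]

theorem mem_absKernel_iff (hr : (μ : Measure K).Regular) {f : C(K, ℂ)} :
    f ∈ absKernel μ ↔ ∀ x ∈ (μ : Measure K).support, f x = 0 := by
  rw [mem_absKernel_iff_ae]
  constructor
  · intro h x hx
    by_contra hne
    exact Measure.subset_compl_support_of_isOpen (t := {x | f x ≠ 0})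
      (isOpen_ne_fun f.continuous continuous_const) h hne hx
  · intro h
    filter_upwards [Measure.support_mem_ae_of_regular (μ := (μ : Measure K))] with x hx
    exact h x hx

theorem idealSupport_absKernel (hr : (μ : Measure K).Regular) :
    idealSupport (absKernel μ) = (μ : Measure K).support :=
  idealSupport_eq_of_mem_iff Measure.isClosed_support fun _ => mem_absKernel_iff hr

/-- Invariance of the ideal follows from `|T f| ≤ T |f|` and the invariance of `μ`. -/
theorem isSIdeal_absKernel (hS : ∀ T ∈ S, IsMarkov T) (hμ : IsInvariantMeasure S μ) :
    IsSIdeal S (absKernel μ) where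
  isClosed := by
    have : (absKernel μ : Set C(K, ℂ)) = ⋂ x ∈ (μ : Measure K).support, {f | f x = 0} := by
      ext f; simp [mem_absKernel_iff hμ.regular]
    rw [this]
    exact isClosed_biInter fun x _ => isClosed_eq (continuous_eval_const x) continuous_const
  invariant T hT f hf := by
    change ∫ x, ‖T f x‖ ∂(μ : Measure K) = 0
    refine le_antisymm ?_ (integral_nonneg fun x => norm_nonneg _)
    calc ∫ x, ‖T f x‖ ∂(μ : Measure K) ≤ ∫ x, realOp T (realModulus f) x ∂(μ : Measure K) :=
          integral_mono (integrable_continuousMap μ (T f)).norm (integrable_real μ _)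
            fun x => norm_apply_le (hS T hT) f x
      _ = 0 := (hμ.integral_realOp hS hT _).trans hf
  ne_top h := by
    have h1 : (1 : C(K, ℂ)) ∈ absKernel μ := h ▸ Submodule.mem_top
    change ∫ x, ‖(1 : C(K, ℂ)) x‖ ∂(μ : Measure K) = 0 at h1
    simp at h1

/-- Fixed vectors of an ergodic measure are almost everywhere constant. -/
theorem IsErgodicMeasure.ae_eq_const (hS : ∀ T ∈ S, IsMarkov T) (hμ : IsErgodicMeasure S μ)
    {h : Lp ℂ 1 (μ : Measure K)} (hh : ∀ T ∈ S, lOneOp μ T h = h) :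
    ∃ c : ℂ, ∀ᵐ x ∂(μ : Measure K), h x = c := by
  have h1 := toLp_one_mem hS hμ.toIsInvariantMeasure
  obtain ⟨c, hc⟩ := (finrank_eq_one_iff_of_nonzero' (⟨_, h1⟩ : lOneFixedSpace S μ)
    (fun h0 => toLp_one_ne_zero μ (congrArg Subtype.val h0))).1 hμ.finrank_eq_one
    ⟨h, mem_lOneFixedSpace.2 hh⟩
  refine ⟨c, ?_⟩
  have e : c • ContinuousMap.toLp 1 (μ : Measure K) ℂ (1 : C(K, ℂ)) = h := congrArg Subtype.val hc
  rw [← map_smul] at e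
  rw [← e]
  filter_upwards [ContinuousMap.coeFn_toLp (p := 1) (𝕜 := ℂ) (μ : Measure K)
    (c • (1 : C(K, ℂ)))] with x hx
  rw [hx]; simp

/-- The zero-one law for supports of invariant ideals. -/
theorem IsErgodicMeasure.measure_idealSupport (hS : ∀ T ∈ S, IsMarkov T)
    (hμ : IsErgodicMeasure S μ) (hI : IsClosedInvariant S I) :
    (μ : Measure K) (idealSupport I) = 0 ∨ (μ : Measure K) (idealSupport I)ᶜ = 0 := by
  have hr := hμ.regular
  have hinv := hμ.toIsInvariantMeasure
  set Z := idealSupport I with hZdef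
  have hZ : IsClosed Z := isClosed_idealSupport I
  set h : Lp ℂ 1 (μ : Measure K) :=
    indicatorConstLp 1 hZ.measurableSet (measure_ne_top (μ : Measure K) Z) (1 : ℂ)
  have hh : h =ᵐ[(μ : Measure K)] Z.indicator fun _ => (1 : ℂ) := indicatorConstLp_coeFn
  -- For a function above the indicator of `Z`, the `L¹` distance to it depends only on the
  -- integral, which `T` preserves.
  have hnorm : ∀ v : C(K, ℝ), (∀ x, Z.indicator (fun _ => (1 : ℝ)) x ≤ v x) →
      ‖ContinuousMap.toLp 1 (μ : Measure K) ℂ (toComplex v) - h‖ =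
        ∫ x, v x ∂(μ : Measure K) - (μ : Measure K).real Z := fun v hv => by
    have h1 : ∫ x, Z.indicator (fun _ => (1 : ℝ)) x ∂(μ : Measure K) = (μ : Measure K).real Z := by
      rw [integral_indicator hZ.measurableSet]; simp
    rw [norm_toLp_sub_eq, ← h1, ← integral_sub (integrable_real μ v)
      ((integrable_const (1 : ℝ)).indicator hZ.measurableSet)]
    refine integral_congr_ae ?_
    filter_upwards [hh] with x hx
    rw [hx]
    have h2 := hv x
    by_cases hxZ : x ∈ Z
    · simp only [hxZ, Set.indicator_of_mem, toComplex_apply] at h2 ⊢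
      rw [← Complex.ofReal_one, ← Complex.ofReal_sub, Complex.norm_real,
        Real.norm_of_nonneg (by linarith)]
    · simp only [hxZ, not_false_eq_true, Set.indicator_of_notMem, toComplex_apply,
        sub_zero] at h2 ⊢
      rw [Complex.norm_real, Real.norm_of_nonneg h2]
  -- Outer regularity and Urysohn's lemma.
  have happrox : ∀ n : ℕ, ∃ u : C(K, ℝ), (∀ x ∈ Z, u x = 1) ∧ (∀ x, 0 ≤ u x) ∧
      ∫ x, u x ∂(μ : Measure K) - (μ : Measure K).real Z ≤ 1 / ((n : ℝ) + 1) := fun n => by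
    obtain ⟨U, hZU, hU, hlt⟩ := Z.exists_isOpen_lt_add (measure_ne_top (μ : Measure K) Z)
      (ε := ENNReal.ofReal (1 / ((n : ℝ) + 1))) (by
        rw [ne_eq, ENNReal.ofReal_eq_zero, not_le]; positivity)
    obtain ⟨u, hu0, hu1, hu⟩ := exists_continuous_zero_one_of_isClosed hU.isClosed_compl hZ
      (Set.disjoint_left.2 fun x hx hxZ => hx (hZU hxZ))
    refine ⟨u, fun x hx => hu1 hx, fun x => (hu x).1, ?_⟩
    have h1 : ∫ x, u x ∂(μ : Measure K) ≤ (μ : Measure K).real U := by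
      calc ∫ x, u x ∂(μ : Measure K) ≤ ∫ x, U.indicator (fun _ => (1 : ℝ)) x ∂(μ : Measure K) := by
            refine integral_mono (integrable_real μ u)
              ((integrable_const (1 : ℝ)).indicator hU.measurableSet) fun x => ?_
            by_cases hx : x ∈ U
            · simp [hx, (hu x).2]
            · simp [hx, hu0 hx]
        _ = _ := by rw [integral_indicator hU.measurableSet]; simp
    have h2 : (μ : Measure K).real U ≤ (μ : Measure K).real Z + 1 / ((n : ℝ) + 1) := by
      have := ENNReal.toReal_mono
        (ENNReal.add_ne_top.2 ⟨measure_ne_top _ _, ENNReal.ofReal_ne_top⟩) hlt.le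
      rwa [ENNReal.toReal_add (measure_ne_top _ _) ENNReal.ofReal_ne_top,
        ENNReal.toReal_ofReal (by positivity)] at this
    linarith
  choose u hu1 hu0 hu using happrox
  have hlim : ∀ v : ℕ → C(K, ℝ), (∀ n x, Z.indicator (fun _ => (1 : ℝ)) x ≤ v n x) →
      (∀ n, ∫ x, v n x ∂(μ : Measure K) = ∫ x, u n x ∂(μ : Measure K)) →
      Filter.Tendsto (fun n => ContinuousMap.toLp 1 (μ : Measure K) ℂ (toComplex (v n)))
        Filter.atTop (𝓝 h) := fun v hv hvu => by
    rw [tendsto_iff_norm_sub_tendsto_zero]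
    refine squeeze_zero (fun n => norm_nonneg _) (fun n => ?_)
      (tendsto_one_div_add_atTop_nhds_zero_nat (𝕜 := ℝ))
    rw [hnorm _ (hv n), hvu]
    exact hu n
  have hlu := hlim u (fun n x => by
    by_cases hx : x ∈ Z
    · simp [hx, hu1 n x hx]
    · simp [hx, hu0 n x]) fun n => rfl
  -- The function `T (u n)` is again 1 on `Z`, nonnegative, and of the same integral as `u n`. Hence
  -- it converges to the same limit, and the indicator is fixed.
  have hfix : ∀ T ∈ S, lOneOp μ T h = h := fun T hT => by
    have h1 := ((lOneOp μ T).continuous.tendsto h).comp hlu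
    refine tendsto_nhds_unique h1 ((hlim (fun n => realOp T (u n)) (fun n x => ?_)
      fun n => hinv.integral_realOp hS hT _).congr fun n => ?_)
    · by_cases hx : x ∈ Z
      · have := apply_eq_self_of_const_on_idealSupport hI hT (hS T hT) (F := toComplex (u n))
          (c := 1) (fun y hy => by simp [hu1 n y hy]) hx
        rw [(hS T hT).apply_toComplex, toComplex_apply] at this
        simp only [hx, Set.indicator_of_mem]
        exact_mod_cast this.ge
      · simp only [hx, not_false_eq_true, Set.indicator_of_notMem]
        exact (hS T hT).isRealMarkov.nonneg (u n) (hu0 n) x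
    · simp only [Function.comp_apply]
      rw [lOneOp_toLp hinv hT (hS T hT), (hS T hT).apply_toComplex]
  obtain ⟨c, hc⟩ := hμ.ae_eq_const hS hfix
  have hind : ∀ᵐ x ∂(μ : Measure K), Z.indicator (fun _ => (1 : ℂ)) x = c := by
    filter_upwards [hc, hh] with x h1 h2
    rw [← h2, h1]
  by_cases hc1 : c = 1
  · right
    rw [← mem_ae_iff]
    filter_upwards [hind] with x hx
    by_contra hxZ
    simp [hxZ, hc1] at hx
  · left
    refine measure_mono_null (fun x hx => ?_) hind
    simpa [hx] using fun h => hc1 h.symm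

theorem IsErgodicMeasure.measure_idealSupport_eq_zero (hS : ∀ T ∈ S, IsMarkov T)
    (hμ : IsErgodicMeasure S μ) (hI : IsClosedInvariant S I) (h : ¬ I ≤ absKernel μ) :
    (μ : Measure K) (idealSupport I) = 0 := by
  refine (hμ.measure_idealSupport hS hI).resolve_right fun h0 => h fun f hf => ?_
  rw [mem_absKernel_iff_ae]
  filter_upwards [mem_ae_iff.2 h0] with x hx
  exact hx f hf

/-- Absolute kernels of ergodic measures are prime among the closed invariant ideals. -/
theorem IsErgodicMeasure.le_or_le_of_inf_le (hS : ∀ T ∈ S, IsMarkov T)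
    (hμ : IsErgodicMeasure S μ) (hI : IsClosedInvariant S I) (hJ : IsClosedInvariant S J)
    (h : I ⊓ J ≤ absKernel μ) : I ≤ absKernel μ ∨ J ≤ absKernel μ := by
  by_contra! hcon
  have hr := hμ.regular
  have h1 := hμ.measure_idealSupport_eq_zero hS hI hcon.1
  have h2 := hμ.measure_idealSupport_eq_zero hS hJ hcon.2
  -- At a point outside both supports some product `f g` with `f ∈ I` and `g ∈ J` is nonzero,
  -- although it lies in `I ⊓ J`.
  have hsub : (μ : Measure K).support ⊆ idealSupport I ∪ idealSupport J := by
    intro x hx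
    by_contra hxn
    simp only [Set.mem_union, not_or] at hxn
    obtain ⟨hxI, hxJ⟩ := hxn
    simp only [idealSupport, Set.mem_ofPred_eq, not_forall] at hxI hxJ
    obtain ⟨f, hf, hfx⟩ := hxI
    obtain ⟨g, hg, hgx⟩ := hxJ
    have := (mem_absKernel_iff hr).1 (h ⟨I.mul_mem_right g hf, J.mul_mem_left f hg⟩) x hx
    exact mul_ne_zero hfx hgx this
  have h3 := measure_mono_null hsub (measure_union_null h1 h2)
  have h4 : ∀ᵐ x ∂(μ : Measure K), x ∈ (μ : Measure K).support :=
    Measure.support_mem_ae_of_regular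
  have h5 : ∀ᵐ x ∂(μ : Measure K), x ∉ (μ : Measure K).support := measure_eq_zero_iff_ae_notMem.1 h3
  obtain ⟨x, hx, hx'⟩ := (h4.and h5).exists
  exact hx' hx

end Ideals

/-! ### The hull-kernel topology -/

section HullKernel

variable {K : Type*} [TopologicalSpace K] [CompactSpace K] [T2Space K]
  [MeasurableSpace K] [BorelSpace K] {S : Subsemigroup (C(K, ℂ) →L[ℂ] C(K, ℂ))}

/-- The primitive ideal of an ergodic measure. -/
def primOf (hS : ∀ T ∈ S, IsMarkov T) {μ : ProbabilityMeasure K} (hμ : IsErgodicMeasure S μ) :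
    Prim S :=
  ⟨absKernel μ, isSIdeal_absKernel hS hμ.toIsInvariantMeasure, μ, hμ, rfl⟩

theorem Prim.isSIdeal (p : Prim S) : IsSIdeal S p.ideal := p.2.1

theorem exists_prim_ge (hS : ∀ T ∈ S, IsMarkov T) (hA : IsRightAmenable S) {ι : Sort*}
    {I : ι → Ideal C(K, ℂ)} (hI : ∀ i, IsClosedInvariant S (I i)) {x : K}
    (hx : ∀ i, x ∈ idealSupport (I i)) : ∃ p : Prim S, ∀ i, I i ≤ p.ideal := by
  obtain ⟨J, hJ, hIJ⟩ := exists_isSIdeal_ge hI hx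
  obtain ⟨μ, hμ, hle⟩ := exists_isErgodicMeasure_le_absKernel hS hA hJ
  exact ⟨primOf hS hμ, fun i => (hIJ i).trans hle⟩

theorem mem_ker {A : Set (Prim S)} {f : C(K, ℂ)} : f ∈ ker A ↔ ∀ p ∈ A, f ∈ p.ideal := by
  simp [ker]

theorem isClosedInvariant_ker (A : Set (Prim S)) : IsClosedInvariant S (ker A) where
  isClosed := by
    have : (ker A : Set C(K, ℂ)) = ⋂ p ∈ A, (p.ideal : Set C(K, ℂ)) := by
      ext f; simp [mem_ker]
    rw [this]
    exact isClosed_biInter fun p _ => p.isSIdeal.isClosed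
  invariant T hT f hf := by
    rw [mem_ker] at hf ⊢
    exact fun p hp => p.isSIdeal.invariant T hT f (hf p hp)

theorem ker_le {A : Set (Prim S)} {p : Prim S} (hp : p ∈ A) : ker A ≤ p.ideal :=
  fun _ hf => mem_ker.1 hf p hp

theorem subset_hull_ker (A : Set (Prim S)) : A ⊆ hull S (ker A) := fun _ hp => ker_le hp

theorem ker_antitone {A B : Set (Prim S)} (h : A ⊆ B) : ker B ≤ ker A :=
  fun _ hf => mem_ker.2 fun p hp => mem_ker.1 hf p (h hp)

theorem hull_ker_mono {A B : Set (Prim S)} (h : A ⊆ B) : hull S (ker A) ⊆ hull S (ker B) :=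
  fun _ hp => (ker_antitone h).trans hp

theorem ker_hull_ker (A : Set (Prim S)) : ker (hull S (ker A : Set C(K, ℂ))) = ker A :=
  le_antisymm (ker_antitone (subset_hull_ker A)) fun _ hf => mem_ker.2 fun _ hp => hp hf

theorem ker_union (A B : Set (Prim S)) : ker (A ∪ B) = ker A ⊓ ker B := by
  ext f
  simp only [mem_ker, Submodule.mem_inf, Set.mem_union]
  exact ⟨fun h => ⟨fun p hp => h p (.inl hp), fun p hp => h p (.inr hp)⟩,
    fun h p hp => hp.elim (h.1 p) (h.2 p)⟩

/-- The nontrivial inclusion is the primeness of primitive ideals; it is the Kuratowski axiom that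
does not hold for formal reasons. -/
theorem hull_ker_union (hS : ∀ T ∈ S, IsMarkov T) (A B : Set (Prim S)) :
    hull S (ker (A ∪ B)) = hull S (ker A) ∪ hull S (ker B) := by
  refine Set.Subset.antisymm (fun p hp => ?_)
    (Set.union_subset (hull_ker_mono Set.subset_union_left) (hull_ker_mono Set.subset_union_right))
  obtain ⟨μ, hμ, hpμ⟩ := p.2.2
  have hp' : ker A ⊓ ker B ≤ absKernel μ := by
    rw [← ker_union, ← hpμ]; exact hp
  have h := hμ.le_or_le_of_inf_le hS (isClosedInvariant_ker A) (isClosedInvariant_ker B) hp'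
  rw [← hpμ] at h
  exact h

theorem hull_ker_empty : hull S (ker (∅ : Set (Prim S))) = ∅ := by
  refine Set.eq_empty_of_forall_notMem fun p hp => p.isSIdeal.ne_top ?_
  refine eq_top_iff.2 fun f _ => hp ?_
  simp [ker]

/-- The generating family is already a topology, so the generated one contains no further open sets.
Finite intersections are covered by `hull_ker_union`, arbitrary unions by monotonicity. -/
theorem isOpen_prim_iff (hS : ∀ T ∈ S, IsMarkov T) {U : Set (Prim S)} :
    IsOpen U ↔ hull S (ker Uᶜ) = Uᶜ := by
  refine ⟨fun h => ?_, fun h => TopologicalSpace.isOpen_generateFrom_of_mem h⟩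
  have h' : TopologicalSpace.GenerateOpen {U : Set (Prim S) | hull S (ker Uᶜ) = Uᶜ} U := h
  clear h
  induction h' with
  | basic U hU => exact hU
  | univ => rw [Set.compl_univ, hull_ker_empty]
  | inter U V _ _ hU hV => rw [Set.compl_inter, hull_ker_union hS, hU, hV]
  | sUnion 𝒰 _ ih =>
    refine Set.Subset.antisymm (fun p hp => ?_) (subset_hull_ker _)
    rintro ⟨U, hU, hpU⟩
    have := hull_ker_mono (Set.compl_subset_compl.2 (Set.subset_sUnion_of_mem hU)) hp
    rw [ih U hU] at this
    exact this hpU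

theorem isClosed_prim_iff (hS : ∀ T ∈ S, IsMarkov T) {A : Set (Prim S)} :
    IsClosed A ↔ hull S (ker A) = A := by
  rw [← isOpen_compl_iff, isOpen_prim_iff hS, compl_compl]

theorem closure_eq_hull_ker (hS : ∀ T ∈ S, IsMarkov T) (A : Set (Prim S)) :
    closure A = hull S (ker A) := by
  refine Set.Subset.antisymm (closure_minimal (subset_hull_ker A)
    ((isClosed_prim_iff hS).2 (by rw [ker_hull_ker]))) ?_
  have h := (isClosed_prim_iff hS).1 (isClosed_closure (s := A))
  rw [← h]
  exact hull_ker_mono subset_closure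

/-- Closed sets with the finite intersection property have kernels whose supports in `K` have it
too. A common point of these supports yields a primitive ideal above all the kernels, that is, a
point of all the closed sets. -/
theorem compactSpace_prim (hS : ∀ T ∈ S, IsMarkov T) (hA : IsRightAmenable S) :
    CompactSpace (Prim S) := by
  refine ⟨isCompact_of_finite_subfamily_closed fun {ι} t ht hempty => ?_⟩
  by_contra! hne
  obtain ⟨x, -, hx⟩ := isCompact_univ.inter_iInter_nonempty
    (fun i => idealSupport (ker (t i))) (fun i => isClosed_idealSupport _) fun u => by
      obtain ⟨p, -, hp⟩ := hne u
      obtain ⟨x, hx⟩ := idealSupport_nonempty p.isSIdeal.isClosed p.isSIdeal.ne_top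
      refine ⟨x, trivial, Set.mem_iInter₂.2 fun i hi => ?_⟩
      exact idealSupport_antitone (ker_le (Set.mem_iInter₂.1 hp i hi)) hx
  obtain ⟨p, hp⟩ := exists_prim_ge hS hA (fun i => isClosedInvariant_ker (t i))
    (fun i => Set.mem_iInter.1 hx i)
  have : p ∈ Set.univ ∩ ⋂ i, t i := ⟨trivial, Set.mem_iInter.2 fun i => by
    rw [← (isClosed_prim_iff hS).1 (ht i)]; exact hp i⟩
  rw [hempty] at this
  exact this

theorem idealSupport_ker (A : Set (Prim S)) :
    idealSupport (ker A) = closure (⋃ p ∈ A, idealSupport p.ideal) := by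
  refine idealSupport_eq_of_mem_iff isClosed_closure fun f => ?_
  rw [mem_ker]
  constructor
  · intro h x hx
    have hsub : (⋃ p ∈ A, idealSupport p.ideal) ⊆ {y | f y = 0} := by
      intro y hy
      obtain ⟨p, hp, hyp⟩ := Set.mem_iUnion₂.1 hy
      exact hyp f (h p hp)
    exact closure_minimal hsub (isClosed_eq f.continuous continuous_const) hx
  · intro h p hp
    refine (mem_iff_of_isClosed p.isSIdeal.isClosed f).2 fun x hx => h x (subset_closure ?_)
    simp only [Set.mem_iUnion]
    exact ⟨p, hp, hx⟩

end HullKernel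

/-! ### The fixed space on `M(S)` and functions on the primitive spectrum -/

section Radical

variable {K : Type*} [TopologicalSpace K] [CompactSpace K] [T2Space K]
  [MeasurableSpace K] [BorelSpace K] {S : Subsemigroup (C(K, ℂ) →L[ℂ] C(K, ℂ))}

theorem hull_zero : hull S {(0 : C(K, ℂ))} = Set.univ :=
  Set.eq_univ_of_forall fun p => Set.singleton_subset_iff.2 p.ideal.zero_mem

theorem radSupport_eq_idealSupport_ker : radSupport S = idealSupport (ker (Set.univ : Set (Prim S))) := by
  rw [radSupport, rad, hull_zero]

theorem radSupport_eq_closure :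
    radSupport S = closure (⋃ p : Prim S, idealSupport p.ideal) := by
  rw [radSupport_eq_idealSupport_ker, idealSupport_ker]
  simp

theorem radSupport_eq_closure_support (hS : ∀ T ∈ S, IsMarkov T) :
    radSupport S =
      closure (⋃ μ ∈ {μ : ProbabilityMeasure K | IsErgodicMeasure S μ},
        (μ : Measure K).support) := by
  rw [radSupport_eq_closure]
  congr 1
  ext x
  simp only [Set.mem_iUnion, Set.mem_ofPred_eq, exists_prop]
  constructor
  · rintro ⟨p, hx⟩
    obtain ⟨μ, hμ, hp⟩ := p.2.2
    refine ⟨μ, hμ, ?_⟩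
    rwa [← idealSupport_absKernel hμ.regular, ← hp]
  · rintro ⟨μ, hμ, hx⟩
    refine ⟨primOf hS hμ, ?_⟩
    rwa [← idealSupport_absKernel hμ.regular] at hx

theorem Prim.idealSupport_subset (p : Prim S) : idealSupport p.ideal ⊆ radSupport S := by
  rw [radSupport_eq_idealSupport_ker]
  exact idealSupport_antitone (ker_le (Set.mem_univ p))

/-- A closed condition on points of `M(S)` which holds on the supports of the primitive ideals
holds everywhere. -/
theorem radSupport_induction {P : radSupport S → Prop} (hP : IsClosed {x | P x})
    (h : ∀ (p : Prim S) (x : radSupport S), (x : K) ∈ idealSupport p.ideal → P x)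
    (x : radSupport S) : P x := by
  have hc : IsClosed (Subtype.val '' {x | P x}) :=
    (isClosed_idealSupport (rad S {0})).isClosedEmbedding_subtypeVal.isClosedMap _ hP
  have hsub : (⋃ p : Prim S, idealSupport p.ideal) ⊆ Subtype.val '' {x | P x} := by
    intro y hy
    obtain ⟨p, hp⟩ := Set.mem_iUnion.1 hy
    exact ⟨⟨y, p.idealSupport_subset hp⟩, h p _ hp, rfl⟩
  have hx : (x : K) ∈ closure (⋃ p : Prim S, idealSupport p.ideal) := by
    rw [← radSupport_eq_closure]; exact x.2
  obtain ⟨y, hy, hyx⟩ := closure_minimal hsub hc hx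
  rwa [← Subtype.ext hyx]

theorem Prim.nonempty_support (p : Prim S) : (idealSupport p.ideal).Nonempty :=
  idealSupport_nonempty p.isSIdeal.isClosed p.isSIdeal.ne_top

/-- A point of the support of a primitive ideal. -/
def Prim.point (p : Prim S) : radSupport S :=
  ⟨p.nonempty_support.choose, p.idealSupport_subset p.nonempty_support.choose_spec⟩

theorem Prim.point_mem (p : Prim S) : (p.point : K) ∈ idealSupport p.ideal :=
  p.nonempty_support.choose_spec

/-- The fixed functions on `M(S)` are those which are constant on the support of each primitive
ideal. -/
theorem mem_radFixedSpace_iff (hS : ∀ T ∈ S, IsMarkov T) {f : C(radSupport S, ℂ)} :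
    f ∈ radFixedSpace S ↔
      ∀ (p : Prim S) (x : radSupport S), (x : K) ∈ idealSupport p.ideal → f x = f p.point := by
  set F := extension (rad S {0}) f with hF
  have hFf : ∀ x : radSupport S, F x = f x := extension_apply _ f
  constructor
  · intro hf p
    obtain ⟨μ, hμ, hp⟩ := p.2.2
    change p.ideal = _ at hp
    have hr := hμ.regular
    have hTF : ∀ T ∈ S, ∀ x : radSupport S, T F x = F x := fun T hT x => by
      have := hf _ ⟨T, hT, rfl⟩
      rw [hFf]
      exact DFunLike.congr_fun this x
    obtain ⟨c, hc⟩ := hμ.ae_eq_const hS (h := ContinuousMap.toLp 1 (μ : Measure K) ℂ F)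
      fun T hT => by
        rw [lOneOp_toLp hμ.toIsInvariantMeasure hT (hS T hT)]
        refine Lp.ext ?_
        filter_upwards [ContinuousMap.coeFn_toLp (p := 1) (𝕜 := ℂ) (μ : Measure K) F,
          ContinuousMap.coeFn_toLp (p := 1) (𝕜 := ℂ) (μ : Measure K) (T F),
          Measure.support_mem_ae_of_regular (μ := (μ : Measure K))] with x h1 h2 h3
        rw [h1, h2]
        rw [← idealSupport_absKernel hr, ← hp] at h3
        exact hTF T hT ⟨x, p.idealSupport_subset h3⟩
    -- Membership in the ideal upgrades equality almost everywhere to equality at every point of the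
    -- support.
    have hmem : F - c • 1 ∈ p.ideal := by
      rw [hp, mem_absKernel_iff_ae]
      filter_upwards [hc, ContinuousMap.coeFn_toLp (p := 1) (𝕜 := ℂ) (μ : Measure K) F] with x h1 h2
      rw [h2] at h1
      simp [h1]
    have hconst : ∀ x : radSupport S, (x : K) ∈ idealSupport p.ideal → f x = c := fun x hx => by
      have := hx _ hmem
      rw [← hFf]
      simpa [sub_eq_zero] using this
    intro x hx
    rw [hconst x hx, hconst _ p.point_mem]
  · rintro hf _ ⟨T, hT, rfl⟩
    ext x
    -- On the support of `p` the extension is constant and `T` fixes constants; density of the union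
    -- of the supports does the rest.
    refine radSupport_induction (P := fun x => T F x = f x)
      (isClosed_eq ((T F).continuous.comp continuous_subtype_val) f.continuous)
      (fun p x hx => ?_) x
    rw [hf p x hx]
    exact apply_eq_self_of_const_on_idealSupport p.isSIdeal.toIsClosedInvariant hT (hS T hT)
      (fun y hy => (hFf ⟨y, p.idealSupport_subset hy⟩).trans (hf p _ hy)) hx

theorem one_mem_radFixedSpace (hS : ∀ T ∈ S, IsMarkov T) :
    (1 : C(radSupport S, ℂ)) ∈ radFixedSpace S :=
  (mem_radFixedSpace_iff hS).2 fun _ _ _ => rfl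

theorem isBanachSublattice_radFixedSpace (hS : ∀ T ∈ S, IsMarkov T) :
    IsBanachSublattice (radFixedSpace S) where
  isClosed := by
    have : (radFixedSpace S : Set C(radSupport S, ℂ)) = ⋂ (p : Prim S) (x : radSupport S)
        (_ : (x : K) ∈ idealSupport p.ideal), {f | f x = f p.point} := by
      ext f; simp [mem_radFixedSpace_iff hS]
    rw [this]
    exact isClosed_iInter fun p => isClosed_iInter fun x => isClosed_iInter fun _ =>
      isClosed_eq (continuous_eval_const _) (continuous_eval_const _)
  star_mem f hf := by
    rw [mem_radFixedSpace_iff hS] at hf ⊢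
    intro p x hx
    simp [hf p x hx]
  modulus_mem f hf := by
    rw [mem_radFixedSpace_iff hS] at hf ⊢
    intro p x hx
    simp [hf p x hx]

/-- The function on the primitive spectrum induced by a function which is constant on the supports
of the primitive ideals. -/
def primFunction (hS : ∀ T ∈ S, IsMarkov T) (f : radFixedSpace S) : C(Prim S, ℂ) where
  toFun p := (f : C(radSupport S, ℂ)) p.point
  continuous_toFun := by
    have hf := (mem_radFixedSpace_iff hS).1 f.2
    refine continuous_iff_isClosed.2 fun C hC => (isClosed_prim_iff hS).2 ?_
    refine Set.Subset.antisymm (fun q hq => ?_) (subset_hull_ker _)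
    have hc : IsClosed (Subtype.val '' {x | (f : C(radSupport S, ℂ)) x ∈ C}) :=
      (isClosed_idealSupport (rad S {0})).isClosedEmbedding_subtypeVal.isClosedMap _
        (hC.preimage (f : C(radSupport S, ℂ)).continuous)
    -- A point of the support of `q` is a limit of points in supports of ideals `p` in the preimage
    -- of `C`; there `f` has values in `C`, which is closed.
    have h1 := idealSupport_antitone hq q.point_mem
    rw [idealSupport_ker] at h1
    obtain ⟨y, hy, hyq⟩ := closure_minimal (fun y hy => by
      obtain ⟨p, hp, hyp⟩ := Set.mem_iUnion₂.1 hy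
      refine ⟨⟨y, p.idealSupport_subset hyp⟩, ?_, rfl⟩
      change (f : C(radSupport S, ℂ)) _ ∈ C
      rw [hf p _ hyp]
      exact hp) hc h1
    rw [Subtype.ext hyq] at hy
    exact hy

/-- The measure is carried by the support of `p`, where `f` is constant. In particular the integral
depends on `μ` only through its absolute kernel. -/
theorem primFunction_eq_integral (hS : ∀ T ∈ S, IsMarkov T) (f : radFixedSpace S) (p : Prim S)
    {μ : ProbabilityMeasure K} (hμ : IsErgodicMeasure S μ) (hp : p.ideal = absKernel μ) :
    primFunction hS f p =
      ∫ x, (f : C(radSupport S, ℂ)) x ∂((μ : Measure K).comap Subtype.val) := by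
  have hr := hμ.regular
  have hf := (mem_radFixedSpace_iff hS).1 f.2
  have hM : MeasurableSet (radSupport S) := (isClosed_idealSupport _).measurableSet
  have hsupp : ∀ᵐ x ∂(μ : Measure K), x ∈ idealSupport p.ideal := by
    rw [hp, idealSupport_absKernel hr]
    exact Measure.support_mem_ae_of_regular
  set F := extension (rad S {0}) (f : C(radSupport S, ℂ)) with hF
  have hFf : ∀ x : radSupport S, F x = (f : C(radSupport S, ℂ)) x := extension_apply _ _
  simp only [← hFf]
  rw [integral_subtype_comap hM (fun x => F x), Measure.restrict_eq_self_of_ae_mem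
    (by filter_upwards [hsupp] with x hx using p.idealSupport_subset hx)]
  have : ∀ᵐ x ∂(μ : Measure K), F x = primFunction hS f p := by
    filter_upwards [hsupp] with x hx
    exact (hFf ⟨x, p.idealSupport_subset hx⟩).trans (hf p _ hx)
  rw [integral_congr_ae this]
  simp

theorem mem_idealSupport_ker_or {A B : Set (Prim S)} (h : A ∪ B = Set.univ) (x : radSupport S) :
    (x : K) ∈ idealSupport (ker A) ∨ (x : K) ∈ idealSupport (ker B) := by
  have hx : (x : K) ∈ idealSupport (ker (A ∪ B)) := by
    rw [h, ← radSupport_eq_idealSupport_ker]; exact x.2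
  rw [idealSupport_ker, Set.biUnion_union, closure_union] at hx
  rwa [idealSupport_ker, idealSupport_ker]

/-- Every continuous function on the primitive spectrum is induced by a continuous function on
`M(S)`. -/
theorem primFunction_surjective (hS : ∀ T ∈ S, IsMarkov T) (hA : IsRightAmenable S) :
    Function.Surjective (primFunction hS) := by
  intro g
  -- The ideals `ker (g ⁻¹' C)` whose supports contain `x` have `x` as a common zero, so one
  -- primitive ideal lies above all of them. The choice of it need not be continuous in `x`; only
  -- the values of `g` on it are shown to be.
  have hex : ∀ x : radSupport S, ∃ p : Prim S, ∀ C : Set ℂ, IsClosed C →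
      (x : K) ∈ idealSupport (ker (g ⁻¹' C)) → g p ∈ C := fun x => by
    obtain ⟨p, hp⟩ := exists_prim_ge hS hA
      (I := fun C : {C : Set ℂ // IsClosed C ∧ (x : K) ∈ idealSupport (ker (g ⁻¹' C))} =>
        ker (g ⁻¹' C.1)) (fun C => isClosedInvariant_ker _) (fun C => C.2.2)
    refine ⟨p, fun C hC hx => ?_⟩
    have h1 : p ∈ hull S (ker (g ⁻¹' C)) := hp ⟨C, hC, hx⟩
    rwa [(isClosed_prim_iff hS).1 (hC.preimage g.continuous)] at h1
  choose q hq using hex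
  have hcont : Continuous fun x => g (q x) := by
    refine continuous_iff_continuousAt.2 fun x => Metric.tendsto_nhds.2 fun ε hε => ?_
    set a := g (q x) with ha
    have hC : IsClosed {z : ℂ | ε / 2 ≤ dist z a} :=
      isClosed_le continuous_const (by fun_prop)
    have hx : (x : K) ∉ idealSupport (ker (g ⁻¹' {z : ℂ | ε / 2 ≤ dist z a})) := fun h => by
      have h1 : ε / 2 ≤ dist (g (q x)) a := hq x _ hC h
      rw [← ha, dist_self] at h1
      linarith
    have hopen : IsOpen {y : radSupport S |
        (y : K) ∉ idealSupport (ker (g ⁻¹' {z : ℂ | ε / 2 ≤ dist z a}))} :=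
      ((isClosed_idealSupport _).preimage continuous_subtype_val).isOpen_compl
    filter_upwards [hopen.mem_nhds hx] with y hy
    -- The preimages of the two closed sets cover `Prim S`, so the supports of their kernels cover
    -- `M(S)`. Near `x` the first support is avoided, which leaves the closed ball.
    have hy' := (mem_idealSupport_ker_or (A := g ⁻¹' {z : ℂ | ε / 2 ≤ dist z a})
      (B := g ⁻¹' Metric.closedBall a (ε / 2)) (by
        refine Set.eq_univ_of_forall fun p => ?_
        exact le_total (ε / 2) (dist (g p) a)) y).resolve_left hy
    have h2 : dist (g (q y)) a ≤ ε / 2 := hq y _ Metric.isClosed_closedBall hy'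
    linarith
  -- With `C = {g p}`, the ideal `p` itself belongs to the preimage.
  have hval : ∀ (p : Prim S) (x : radSupport S), (x : K) ∈ idealSupport p.ideal →
      g (q x) = g p := fun p x hx =>
    hq x {g p} isClosed_singleton (idealSupport_antitone (ker_le (by simp)) hx)
  refine ⟨⟨⟨fun x => g (q x), hcont⟩, (mem_radFixedSpace_iff hS).2 fun p x hx => ?_⟩, ?_⟩
  · exact (hval p x hx).trans (hval p _ p.point_mem).symm
  · ext p
    exact hval p _ p.point_mem

/-- The values on `Prim S` are exactly those of `f` on the supports of the primitive ideals, whose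
union is dense in `M(S)`. -/
theorem norm_primFunction [CompactSpace (Prim S)] (hS : ∀ T ∈ S, IsMarkov T)
    (f : radFixedSpace S) : ‖primFunction hS f‖ = ‖f‖ := by
  have hf := (mem_radFixedSpace_iff hS).1 f.2
  refine le_antisymm ?_ ?_
  · exact (ContinuousMap.norm_le _ (norm_nonneg _)).2 fun p =>
      (f : C(radSupport S, ℂ)).norm_coe_le_norm p.point
  · refine (ContinuousMap.norm_le (f : C(radSupport S, ℂ)) (norm_nonneg _)).2 fun x => ?_
    refine radSupport_induction (P := fun x => ‖(f : C(radSupport S, ℂ)) x‖ ≤ ‖primFunction hS f‖)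
      (isClosed_le (f : C(radSupport S, ℂ)).continuous.norm continuous_const)
      (fun p x hx => ?_) x
    rw [hf p x hx]
    exact (primFunction hS f).norm_coe_le_norm p

/-- The isometric isomorphism of the fixed space onto the continuous functions on the primitive
spectrum. -/
def primEquiv [CompactSpace (Prim S)] (hS : ∀ T ∈ S, IsMarkov T) (hA : IsRightAmenable S) :
    radFixedSpace S ≃ₗᵢ[ℂ] C(Prim S, ℂ) :=
  LinearIsometryEquiv.ofSurjective
    { toFun := primFunction hS
      map_add' := fun _ _ => rfl
      map_smul' := fun _ _ => rfl
      norm_map' := norm_primFunction hS } (primFunction_surjective hS hA)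

theorem isMarkovLatticeIso_primEquiv [CompactSpace (Prim S)] (hS : ∀ T ∈ S, IsMarkov T)
    (hA : IsRightAmenable S) :
    IsMarkovLatticeIso (radFixedSpace S) (primEquiv hS hA).toLinearEquiv where
  map_one := ⟨one_mem_radFixedSpace hS, rfl⟩
  nonneg_iff f := by
    have hf := (mem_radFixedSpace_iff hS).1 f.2
    refine ⟨fun h x => ?_, fun h p => h p.point⟩
    refine radSupport_induction (P := fun x => 0 ≤ (f : C(radSupport S, ℂ)) x)
      (isClosed_le continuous_const (f : C(radSupport S, ℂ)).continuous) (fun p x hx => ?_) x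
    rw [hf p x hx]
    exact h p
  map_star f := ⟨(isBanachSublattice_radFixedSpace hS).star_mem f f.2, rfl⟩
  map_modulus f := ⟨(isBanachSublattice_radFixedSpace hS).modulus_mem f f.2, rfl⟩

end Radical

end

end MarkovSemigroup

-- Quasi-compactness is supplied as an instance inside the existential because the supremum norm on
-- `C(Prim S, ℂ)`, and so the isometry type, depends on it. Pulling `μ` back along the inclusion of
-- `M(S)` loses no mass, since `M(S)` contains the support of `μ`.
open MarkovSemigroup in
theorem theorem6p3 {K : Type*} [TopologicalSpace K] [CompactSpace K] [T2Space K]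
    [MeasurableSpace K] [BorelSpace K]
    (S : Subsemigroup (C(K, ℂ) →L[ℂ] C(K, ℂ)))
    (hMarkov : ∀ T ∈ S, IsMarkov T) (hAmenable : IsRightAmenable S) :
    (∀ A : Set (Prim S), closure A = hull S (ker A)) ∧
    radSupport S =
      closure (⋃ μ ∈ {μ : ProbabilityMeasure K | IsErgodicMeasure S μ}, (μ : Measure K).support) ∧
    IsBanachSublattice (radFixedSpace S) ∧
    ∃ (_ : CompactSpace (Prim S)) (Φ : radFixedSpace S ≃ₗᵢ[ℂ] C(Prim S, ℂ)),
      (∀ (f : radFixedSpace S) (p : Prim S) (μ : ProbabilityMeasure K), IsErgodicMeasure S μ →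
        p.ideal = absKernel μ →
        Φ f p = ∫ x, (f : C(radSupport S, ℂ)) x ∂((μ : Measure K).comap Subtype.val)) ∧
      IsMarkovLatticeIso (radFixedSpace S) Φ.toLinearEquiv := by
  have hcompact := compactSpace_prim hMarkov hAmenable
  exact ⟨closure_eq_hull_ker hMarkov, radSupport_eq_closure_support hMarkov,
    isBanachSublattice_radFixedSpace hMarkov, hcompact, primEquiv hMarkov hAmenable,
    fun f p μ hμ hp => primFunction_eq_integral hMarkov f p hμ hp,
    isMarkovLatticeIso_primEquiv hMarkov hAmenable⟩
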